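/- Let $L>0$, $\omega>0$ and $p>1$, and let $\mathbb S_L=\mathbb R\times[0,L]$. For complex-valued $u\in H^1(\mathbb S_L)$ put $$S_{\omega,0}(u)=\tfrac12\|\nabla u\|_{L^2(\mathbb S_L)}^2+\tfrac{\omega}{2}\|u\|_{L^2(\mathbb S_L)}^2-\tfrac1{p+1}\|u\|_{L^{p+1}(\mathbb S_L)}^{p+1},$$ $$I_{\omega,0}(u)=\|\nabla u\|_{L^2(\mathbb S_L)}^2+\omega\|u\|_{L^2(\mathbb S_L)}^2-\|u\|_{L^{p+1}(\mathbb S_L)}^{p+1},$$ and $$s_{\omega,0}=\inf\{S_{\omega,0}(u):u\in H^1(\mathbb S_L)\setminus\{0\},\ I_{\omega,0}(u)=0\}.$$ Then $s_{\omega,0}$ has a non-negative minimizer: there is a real-valued $\varphi\ge 0$ with $\varphi\in H^1(\mathbb S_L)\setminus\{0\}$, $I_{\omega,0}(\varphi)=0$ and $S_{\omega,0}(\varphi)=s_{\omega,0}$. -/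

import Mathlib

open Set MeasureTheory

noncomputable section

namespace StripNLS

/-- The strip `ℝ × [0, L]`, with coordinates `(x, y)`. -/
def strip (L : ℝ) : Set (ℝ × ℝ) := univ ×ˢ Icc 0 L

/-- The open strip `ℝ × (0, L)`, on which test functions are supported. -/
def openStrip (L : ℝ) : Set (ℝ × ℝ) := univ ×ˢ Ioo 0 L

/-- Smooth compactly supported test functions on the open strip. -/
structure IsTestFunction (L : ℝ) (φ : ℝ × ℝ → ℝ) : Prop where
  smooth : ContDiff ℝ (⊤ : ℕ∞) φ
  compact : HasCompactSupport φ
  supp : tsupport φ ⊆ openStrip L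

/-- `g ∈ L²` is the weak (distributional) derivative of `u` in the direction `v` on the strip. -/
structure HasL2WeakDeriv (L : ℝ) (v : ℝ × ℝ) (u g : ℝ × ℝ → ℂ) : Prop where
  memLp : MemLp g 2 (volume.restrict (strip L))
  integral_eq : ∀ φ : ℝ × ℝ → ℝ, IsTestFunction L φ →
    ∫ z in strip L, fderiv ℝ φ z v • u z = - ∫ z in strip L, φ z • g z

/-- `u` belongs to the Sobolev space `H¹` of the strip (complex-valued functions): `u` and its
weak partial derivatives are in `L²`. The values of `u` outside the strip play no role. -/
structure MemH1 (L : ℝ) (u : ℝ × ℝ → ℂ) : Prop where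
  memLp : MemLp u 2 (volume.restrict (strip L))
  exists_dx : ∃ g, HasL2WeakDeriv L (1, 0) u g
  exists_dy : ∃ g, HasL2WeakDeriv L (0, 1) u g

open Classical in
/-- The weak derivative of `u` in the direction `v` on the strip; it is unique up to a null set
(see `HasL2WeakDeriv.ae_eq`). The value `0` is used when there is none in `L²`. -/
def weakDeriv (L : ℝ) (v : ℝ × ℝ) (u : ℝ × ℝ → ℂ) : ℝ × ℝ → ℂ :=
  if h : ∃ g, HasL2WeakDeriv L v u g then h.choose else 0

theorem weakDeriv_spec {L : ℝ} {v : ℝ × ℝ} {u : ℝ × ℝ → ℂ}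
    (h : ∃ g, HasL2WeakDeriv L v u g) : HasL2WeakDeriv L v u (weakDeriv L v u) := by
  unfold weakDeriv
  rw [dif_pos h]
  exact h.choose_spec

theorem strip_ae_eq (L : ℝ) : (strip L : Set (ℝ × ℝ)) =ᵐ[volume] openStrip L := by
  unfold strip openStrip
  exact Measure.set_prod_ae_eq (Filter.EventuallyEq.refl _ _) Ioo_ae_eq_Icc.symm

theorem isOpen_openStrip (L : ℝ) : IsOpen (openStrip L) := isOpen_univ.prod isOpen_Ioo

theorem HasL2WeakDeriv.ae_eq {L : ℝ} {v : ℝ × ℝ} {u g₁ g₂ : ℝ × ℝ → ℂ}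
    (h₁ : HasL2WeakDeriv L v u g₁) (h₂ : HasL2WeakDeriv L v u g₂) :
    g₁ =ᵐ[volume.restrict (strip L)] g₂ := by
  have hr : volume.restrict (strip L) = volume.restrict (openStrip L) :=
    Measure.restrict_congr_set (strip_ae_eq L)
  have hm := h₁.memLp.sub h₂.memLp
  have hl : LocallyIntegrable (g₁ - g₂) (volume.restrict (strip L)) :=
    hm.locallyIntegrable (by norm_num)
  have hint : ∀ (g : ℝ × ℝ → ℂ), MemLp g 2 (volume.restrict (strip L)) →
      ∀ φ, IsTestFunction L φ → Integrable (fun z => φ z • g z) (volume.restrict (strip L)) := by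
    intro g hg φ hφ
    exact (hg.locallyIntegrable (by norm_num)).integrable_smul_left_of_hasCompactSupport
      hφ.smooth.continuous hφ.compact
  have key : ∀ᵐ z ∂(volume.restrict (strip L)), z ∈ openStrip L → (g₁ - g₂) z = 0 := by
    refine (isOpen_openStrip L).ae_eq_zero_of_integral_contDiff_smul_eq_zero
      (hl.locallyIntegrableOn _) ?_
    intro φ h1 h2 h3
    have hφ : IsTestFunction L φ := ⟨h1, h2, h3⟩
    have e := (h₁.integral_eq φ hφ).symm.trans (h₂.integral_eq φ hφ)
    simp only [Pi.sub_apply, smul_sub]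
    rw [integral_sub (hint g₁ h₁.memLp φ hφ) (hint g₂ h₂.memLp φ hφ), neg_inj.mp e, sub_self]
  rw [hr] at key ⊢
  filter_upwards [key, ae_restrict_mem (isOpen_openStrip L).measurableSet] with z hz hz'
  exact sub_eq_zero.mp (hz hz')

/-- `‖u‖²` in `L²` of the strip. -/
def massSq (L : ℝ) (u : ℝ × ℝ → ℂ) : ℝ := ∫ z in strip L, ‖u z‖ ^ 2

/-- `‖∇u‖²` in `L²` of the strip. -/
def gradSq (L : ℝ) (u : ℝ × ℝ → ℂ) : ℝ :=
  ∫ z in strip L, (‖weakDeriv L (1, 0) u z‖ ^ 2 + ‖weakDeriv L (0, 1) u z‖ ^ 2)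

/-- `‖u‖^{p+1}` in `L^{p+1}` of the strip. -/
def potential (L p : ℝ) (u : ℝ × ℝ → ℂ) : ℝ := ∫ z in strip L, ‖u z‖ ^ (p + 1)

/-- The action functional (without delta term). -/
def action (L p ω : ℝ) (u : ℝ × ℝ → ℂ) : ℝ :=
  1 / 2 * gradSq L u + ω / 2 * massSq L u - 1 / (p + 1) * potential L p u

/-- The Nehari functional (without delta term). -/
def nehari (L p ω : ℝ) (u : ℝ × ℝ → ℂ) : ℝ :=
  gradSq L u + ω * massSq L u - potential L p u

/-- The admissible set: `u ∈ H¹`, `u ≠ 0` (as a class modulo null sets), vanishing Nehari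
functional. -/
def admissible (L p ω : ℝ) : Set (ℝ × ℝ → ℂ) :=
  {u | MemH1 L u ∧ ¬ u =ᵐ[volume.restrict (strip L)] 0 ∧ nehari L p ω u = 0}

/-- The infimum of the action over the admissible set. -/
def actionInf (L p ω : ℝ) : ℝ := sInf (action L p ω '' admissible L p ω)

/-- `u` is a minimizer: it is admissible, its action is least among all admissible functions, and
its action is the infimum `actionInf`. -/
structure IsActionMinimizer (L p ω : ℝ) (u : ℝ × ℝ → ℂ) : Prop where
  mem : u ∈ admissible L p ω
  isMinOn : IsMinOn (action L p ω) (admissible L p ω) u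
  action_eq : action L p ω u = actionInf L p ω

end StripNLS

end

noncomputable section

namespace StripNLS

open Filter
open scoped ENNReal Topology Convolution ComplexConjugate

/-! Write Q(u) = ‖∇u‖² + ω‖u‖² and P(u) = ‖u‖^{p+1} in L^{p+1}. On the admissible set Q = P, so the
action there is (1/2 − 1/(p+1)) Q with a positive coefficient, and the problem is to minimize Q. Let
m be the infimum of Q. The constraint can be relaxed to Q ≤ P: if u ≠ 0 satisfies it, then t u is
admissible for some 0 < t ≤ 1 (`SobolevTriple.exists_smul_mem_admissible`), and therefore m ≤ t²
Q(u) ≤ Q(u).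

Compactness can fail only through translations in x. Cut the strip into unit blocks. Since Q = P
globally, some block carries Q ≤ P with Q ≠ 0, and the Sobolev inequality on that block bounds its
share of P below by a constant δ > 0 (`exists_block_lower_bound`). Translating that block to the
origin gives a minimizing sequence whose weak limit a is nonzero, by local compactness
(`tendsto_lintegral_rpow_rect`).

Both functionals split along the sequence: Q(xₙ) − Q(xₙ − a) → Q(a) by Hilbert space geometry, and
P(xₙ) − P(xₙ − a) → P(a) by a Brezis–Lieb argument (`tendsto_potential_sub`). If Q(a) > P(a), the
remainders eventually satisfy Q < P, so Q(xₙ − a) ≥ m; in the limit m − Q(a) ≥ m, which contradicts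
Q(a) > 0. Hence Q(a) ≤ P(a), and Q(a) ≤ m because the remainders have Q ≥ 0. Passing to |a| keeps P
and does not increase Q (`HasL2WeakDeriv.exists_norm`); rescaling |a| by t ≤ 1 gives the minimizer.

The H¹ theory needed (Sobolev, Poincaré, Rellich, difference quotients) is derived from the weak
derivative definition: each inequality is proved for C¹ functions in `ℝ≥0∞`, then passed to
mollifications and to the limit by Fatou. -/

/-! ### Cauchy–Schwarz and one-dimensional estimates -/

theorem sq_lintegral_mul_le {α : Type*} [MeasurableSpace α] {μ : Measure α} {f g : α → ℝ≥0∞}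
    (hf : AEMeasurable f μ) (hg : AEMeasurable g μ) :
    (∫⁻ a, f a * g a ∂μ) ^ 2 ≤ (∫⁻ a, f a ^ 2 ∂μ) * ∫⁻ a, g a ^ 2 ∂μ := by
  have h := ENNReal.lintegral_mul_le_Lp_mul_Lq μ Real.HolderConjugate.two_two hf hg
  have e : ∀ x : ℝ≥0∞, (x ^ (1 / 2 : ℝ)) ^ 2 = x := fun x => by
    rw [← ENNReal.rpow_natCast, ← ENNReal.rpow_mul]; norm_num
  calc (∫⁻ a, f a * g a ∂μ) ^ 2
      ≤ ((∫⁻ a, f a ^ (2 : ℝ) ∂μ) ^ (1 / 2 : ℝ) * (∫⁻ a, g a ^ (2 : ℝ) ∂μ) ^ (1 / 2 : ℝ)) ^ 2 :=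
        pow_le_pow_left' h 2
    _ = _ := by
        rw [mul_pow, e, e]
        simp_rw [← ENNReal.rpow_two]

theorem sq_lintegral_le {α : Type*} [MeasurableSpace α] {μ : Measure α} {f : α → ℝ≥0∞}
    (hf : AEMeasurable f μ) :
    (∫⁻ a, f a ∂μ) ^ 2 ≤ μ univ * ∫⁻ a, f a ^ 2 ∂μ := by
  have := sq_lintegral_mul_le (f := fun _ => (1 : ℝ≥0∞)) aemeasurable_const hf
  simpa using this

theorem sq_add_le (x y : ℝ≥0∞) : (x + y) ^ 2 ≤ 2 * (x ^ 2 + y ^ 2) := by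
  have h := ENNReal.rpow_add_le_mul_rpow_add_rpow x y (p := 2) (by norm_num)
  norm_num [ENNReal.rpow_two] at h
  exact h

theorem enorm_sub_le_lintegral_deriv {f f' : ℝ → ℂ} (hf : ∀ x, HasDerivAt f (f' x) x)
    (hc : Continuous f') {a b s t : ℝ} (hs : s ∈ Icc a b) (ht : t ∈ Icc a b) :
    ‖f s - f t‖ₑ ≤ ∫⁻ x in Icc a b, ‖f' x‖ₑ := by
  wlog h : t ≤ s generalizing s t
  · rw [← enorm_neg, neg_sub]
    exact this ht hs (le_of_not_ge h)
  rw [← intervalIntegral.integral_eq_sub_of_hasDerivAt (fun x _ => hf x)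
    (hc.intervalIntegrable t s), intervalIntegral.integral_of_le h]
  refine (enorm_integral_le_lintegral_enorm _).trans (lintegral_mono_set ?_)
  intro x hx
  exact ⟨ht.1.trans hx.1.le, hx.2.trans hs.2⟩

theorem enorm_sub_sq_le_lintegral_deriv {f f' : ℝ → ℂ} (hf : ∀ x, HasDerivAt f (f' x) x)
    (hc : Continuous f') {a b s t : ℝ} (hs : s ∈ Icc a b) (ht : t ∈ Icc a b) :
    ‖f s - f t‖ₑ ^ 2 ≤ ENNReal.ofReal (b - a) * ∫⁻ x in Icc a b, ‖f' x‖ₑ ^ 2 := by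
  refine (pow_le_pow_left' (enorm_sub_le_lintegral_deriv hf hc hs ht) 2).trans ?_
  refine (sq_lintegral_le hc.enorm.aemeasurable).trans ?_
  simp

/-- Average |f(s)| ≤ |f(x)| + ∫|f'| over x in the interval. No boundary condition is needed, which
is why the term |f| appears. -/
theorem mul_enorm_le_lintegral_deriv {f f' : ℝ → ℂ} (hf : ∀ x, HasDerivAt f (f' x) x)
    (hc : Continuous f') {a b s : ℝ} (hs : s ∈ Icc a b) :
    ENNReal.ofReal (b - a) * ‖f s‖ₑ ≤
      ∫⁻ x in Icc a b, (‖f x‖ₑ + ENNReal.ofReal (b - a) * ‖f' x‖ₑ) := by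
  have hcf : Continuous f := continuous_iff_continuousAt.2 fun x => (hf x).continuousAt
  calc ENNReal.ofReal (b - a) * ‖f s‖ₑ = ∫⁻ _ in Icc a b, ‖f s‖ₑ := by simp [mul_comm]
    _ ≤ ∫⁻ x in Icc a b, (‖f x‖ₑ + ∫⁻ t in Icc a b, ‖f' t‖ₑ) := by
        refine setLIntegral_mono' measurableSet_Icc fun x hx => ?_
        calc ‖f s‖ₑ = ‖f x + (f s - f x)‖ₑ := by congr 1; ring
          _ ≤ ‖f x‖ₑ + ‖f s - f x‖ₑ := enorm_add_le _ _
          _ ≤ _ := by gcongr; exact enorm_sub_le_lintegral_deriv hf hc hs hx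
    _ = _ := by
        rw [lintegral_add_left hcf.enorm.measurable, lintegral_add_left hcf.enorm.measurable,
          lintegral_const_mul _ hc.enorm.measurable]
        simp [mul_comm]

/-! ### Poincaré and Sobolev inequalities for C¹ functions on rectangles -/

/-- The closed rectangle `[a, b] × [c, d]`. -/
def rect (a b c d : ℝ) : Set (ℝ × ℝ) := Icc a b ×ˢ Icc c d

theorem measurableSet_rect (a b c d : ℝ) : MeasurableSet (rect a b c d) :=
  measurableSet_Icc.prod measurableSet_Icc

theorem volume_restrict_rect (a b c d : ℝ) : (volume : Measure (ℝ × ℝ)).restrict (rect a b c d) =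
    (volume.restrict (Icc a b)).prod (volume.restrict (Icc c d)) := by
  rw [Measure.prod_restrict, ← Measure.volume_eq_prod]; rfl

theorem volume_rect (a b c d : ℝ) : (volume : Measure (ℝ × ℝ)) (rect a b c d) =
    ENNReal.ofReal (b - a) * ENNReal.ofReal (d - c) := by
  rw [rect, Measure.volume_eq_prod, Measure.prod_prod, Real.volume_Icc, Real.volume_Icc]

section Smooth

variable {f : ℝ × ℝ → ℂ}

theorem hasDerivAt_fst (hf : ContDiff ℝ 1 f) (x y : ℝ) :
    HasDerivAt (fun s => f (s, y)) (fderiv ℝ f (x, y) (1, 0)) x := by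
  have h := ((hf.differentiable one_ne_zero) (x, y)).hasFDerivAt
  exact h.comp_hasDerivAt x ((hasDerivAt_id x).prodMk (hasDerivAt_const x y))

theorem hasDerivAt_snd (hf : ContDiff ℝ 1 f) (x y : ℝ) :
    HasDerivAt (fun s => f (x, s)) (fderiv ℝ f (x, y) (0, 1)) y := by
  have h := ((hf.differentiable one_ne_zero) (x, y)).hasFDerivAt
  exact h.comp_hasDerivAt y ((hasDerivAt_const y x).prodMk (hasDerivAt_id y))

theorem continuous_fderiv_dir (hf : ContDiff ℝ 1 f) (v : ℝ × ℝ) :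
    Continuous fun z => fderiv ℝ f z v :=
  (hf.continuous_fderiv one_ne_zero).clm_apply continuous_const

/-- Travel from z to w through the corner (w.1, z.2). The horizontal leg is bounded by a function of
z.2 alone and the vertical leg by a function of w.1 alone, so the double integral factorizes. The
form with two variables involves no mean value and passes directly to limits. -/
theorem poincare_smooth (hf : ContDiff ℝ 1 f) (a b c d : ℝ) :
    ∫⁻ z in rect a b c d, ∫⁻ w in rect a b c d, ‖f z - f w‖ₑ ^ 2 ≤
      2 * (ENNReal.ofReal (b - a) * ENNReal.ofReal (d - c)) *
        (ENNReal.ofReal (b - a) ^ 2 * (∫⁻ z in rect a b c d, ‖fderiv ℝ f z (1, 0)‖ₑ ^ 2) +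
         ENNReal.ofReal (d - c) ^ 2 * ∫⁻ z in rect a b c d, ‖fderiv ℝ f z (0, 1)‖ₑ ^ 2) := by
  have cx := continuous_fderiv_dir hf (1, 0)
  have cy := continuous_fderiv_dir hf (0, 1)
  set A := ENNReal.ofReal (b - a) with hA
  set B := ENNReal.ofReal (d - c) with hB
  set G : ℝ → ℝ≥0∞ := fun y => ∫⁻ s in Icc a b, ‖fderiv ℝ f (s, y) (1, 0)‖ₑ ^ 2 with hG
  set H : ℝ → ℝ≥0∞ := fun x => ∫⁻ t in Icc c d, ‖fderiv ℝ f (x, t) (0, 1)‖ₑ ^ 2 with hH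
  have mG : Measurable G :=
    Measurable.lintegral_prod_left' (f := fun z : ℝ × ℝ => ‖fderiv ℝ f z (1, 0)‖ₑ ^ 2)
      (by fun_prop)
  have mH : Measurable H :=
    Measurable.lintegral_prod_right' (f := fun z : ℝ × ℝ => ‖fderiv ℝ f z (0, 1)‖ₑ ^ 2)
      (by fun_prop)
  have IG : ∫⁻ y in Icc c d, G y = ∫⁻ z in rect a b c d, ‖fderiv ℝ f z (1, 0)‖ₑ ^ 2 := by
    rw [volume_restrict_rect, lintegral_prod_symm _ (by fun_prop)]
  have IH : ∫⁻ x in Icc a b, H x = ∫⁻ z in rect a b c d, ‖fderiv ℝ f z (0, 1)‖ₑ ^ 2 := by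
    rw [volume_restrict_rect, lintegral_prod _ (by fun_prop)]
  have hpt : ∀ z ∈ rect a b c d, ∀ w ∈ rect a b c d,
      ‖f z - f w‖ₑ ^ 2 ≤ 2 * (A * G z.2) + 2 * (B * H w.1) := by
    intro z hz w hw
    have h1 : ‖f z - f (w.1, z.2)‖ₑ ^ 2 ≤ A * G z.2 :=
      enorm_sub_sq_le_lintegral_deriv (f := fun s => f (s, z.2)) (fun x => hasDerivAt_fst hf x z.2)
        (cx.comp (by fun_prop)) hz.1 hw.1
    have h2 : ‖f (w.1, z.2) - f w‖ₑ ^ 2 ≤ B * H w.1 :=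
      enorm_sub_sq_le_lintegral_deriv (f := fun s => f (w.1, s)) (fun x => hasDerivAt_snd hf w.1 x)
        (cy.comp (by fun_prop)) hz.2 hw.2
    calc ‖f z - f w‖ₑ ^ 2 = ‖(f z - f (w.1, z.2)) + (f (w.1, z.2) - f w)‖ₑ ^ 2 := by
          congr 2; ring
      _ ≤ (‖f z - f (w.1, z.2)‖ₑ + ‖f (w.1, z.2) - f w‖ₑ) ^ 2 :=
          pow_le_pow_left' (enorm_add_le _ _) 2
      _ ≤ 2 * (‖f z - f (w.1, z.2)‖ₑ ^ 2 + ‖f (w.1, z.2) - f w‖ₑ ^ 2) := by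
          exact sq_add_le _ _
      _ ≤ _ := by rw [mul_add]; gcongr
  have hm := measurableSet_rect a b c d
  calc _ ≤ ∫⁻ z in rect a b c d, ∫⁻ w in rect a b c d, (2 * (A * G z.2) + 2 * (B * H w.1)) :=
        setLIntegral_mono' hm fun z hz => setLIntegral_mono' hm fun w hw => hpt z hz w hw
    _ = _ := by
        have e1 : ∫⁻ z in rect a b c d, G z.2 = A * ∫⁻ y in Icc c d, G y := by
          rw [volume_restrict_rect]
          have := lintegral_prod_mul (μ := volume.restrict (Icc a b))
            (ν := volume.restrict (Icc c d)) (f := fun _ => 1) (g := G) (by fun_prop)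
            mG.aemeasurable
          simpa using this
        have e2 : ∫⁻ z in rect a b c d, H z.1 = (∫⁻ y in Icc a b, H y) * B := by
          rw [volume_restrict_rect]
          have := lintegral_prod_mul (μ := volume.restrict (Icc a b))
            (ν := volume.restrict (Icc c d)) (g := fun _ => 1) (f := H) mH.aemeasurable
            (by fun_prop)
          simpa using this
        have m2 : Measurable fun w : ℝ × ℝ => H w.1 := mH.comp measurable_fst
        have m1 : Measurable fun w : ℝ × ℝ => G w.2 := mG.comp measurable_snd
        have : ∀ z : ℝ × ℝ, ∫⁻ w in rect a b c d, (2 * (A * G z.2) + 2 * (B * H w.1)) =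
            2 * A * (A * B) * G z.2 + 2 * B * ((∫⁻ x in Icc a b, H x) * B) := fun z => by
          rw [lintegral_add_left (by fun_prop), lintegral_const_mul _ (m2.const_mul B),
            lintegral_const_mul _ m2, e2]
          simp only [lintegral_const, Measure.restrict_apply MeasurableSet.univ, univ_inter,
            volume_rect, ← hA, ← hB]
          ring
        simp_rw [this]
        rw [lintegral_add_right _ (by fun_prop), lintegral_const_mul _ m1, e1, IG, IH]
        simp only [lintegral_const, Measure.restrict_apply MeasurableSet.univ, univ_inter,
            volume_rect, ← hA, ← hB]
        ring

/-- Bound one factor of |f|² by a function of y and the other by a function of x, each from the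
one-dimensional estimate; the integral of the product is the product of the integrals. This is the
embedding of W^{1,1} into L² in the plane. -/
theorem ladyzhenskaya_smooth (hf : ContDiff ℝ 1 f) (a b c d : ℝ) :
    ENNReal.ofReal (b - a) * ENNReal.ofReal (d - c) * ∫⁻ z in rect a b c d, ‖f z‖ₑ ^ 2 ≤
      (∫⁻ z in rect a b c d, (‖f z‖ₑ + ENNReal.ofReal (b - a) * ‖fderiv ℝ f z (1, 0)‖ₑ)) *
      (∫⁻ z in rect a b c d, (‖f z‖ₑ + ENNReal.ofReal (d - c) * ‖fderiv ℝ f z (0, 1)‖ₑ)) := by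
  have cx := continuous_fderiv_dir hf (1, 0)
  have cy := continuous_fderiv_dir hf (0, 1)
  have cf := hf.continuous
  set A := ENNReal.ofReal (b - a) with hA
  set B := ENNReal.ofReal (d - c) with hB
  set G : ℝ → ℝ≥0∞ := fun y =>
    ∫⁻ s in Icc a b, (‖f (s, y)‖ₑ + A * ‖fderiv ℝ f (s, y) (1, 0)‖ₑ) with hG
  set H : ℝ → ℝ≥0∞ := fun x =>
    ∫⁻ t in Icc c d, (‖f (x, t)‖ₑ + B * ‖fderiv ℝ f (x, t) (0, 1)‖ₑ) with hH
  have mG : Measurable G := Measurable.lintegral_prod_left'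
      (f := fun z : ℝ × ℝ => ‖f z‖ₑ + A * ‖fderiv ℝ f z (1, 0)‖ₑ) (by fun_prop)
  have mH : Measurable H := Measurable.lintegral_prod_right'
      (f := fun z : ℝ × ℝ => ‖f z‖ₑ + B * ‖fderiv ℝ f z (0, 1)‖ₑ) (by fun_prop)
  have IG : ∫⁻ y in Icc c d, G y =
      ∫⁻ z in rect a b c d, (‖f z‖ₑ + A * ‖fderiv ℝ f z (1, 0)‖ₑ) := by
    rw [volume_restrict_rect, lintegral_prod_symm _ (by fun_prop)]
  have IH : ∫⁻ x in Icc a b, H x =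
      ∫⁻ z in rect a b c d, (‖f z‖ₑ + B * ‖fderiv ℝ f z (0, 1)‖ₑ) := by
    rw [volume_restrict_rect, lintegral_prod _ (by fun_prop)]
  rw [← IG, ← IH, ← lintegral_const_mul _ (by fun_prop)]
  calc _ ≤ ∫⁻ z in rect a b c d, H z.1 * G z.2 := by
        refine setLIntegral_mono' (measurableSet_rect a b c d) fun z hz => ?_
        have h1 : A * ‖f z‖ₑ ≤ G z.2 := mul_enorm_le_lintegral_deriv (f := fun s => f (s, z.2))
          (fun x => hasDerivAt_fst hf x z.2) (cx.comp (by fun_prop)) hz.1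
        have h2 : B * ‖f z‖ₑ ≤ H z.1 := mul_enorm_le_lintegral_deriv (f := fun s => f (z.1, s))
          (fun x => hasDerivAt_snd hf z.1 x) (cy.comp (by fun_prop)) hz.2
        calc A * B * ‖f z‖ₑ ^ 2 = (B * ‖f z‖ₑ) * (A * ‖f z‖ₑ) := by ring
          _ ≤ _ := by gcongr
    _ = _ := by
        rw [volume_restrict_rect, lintegral_prod_mul mH.aemeasurable mG.aemeasurable, mul_comm]

theorem fderiv_pow_apply (hf : ContDiff ℝ 1 f) (s : ℕ) (z v : ℝ × ℝ) :
    fderiv ℝ (fun z => f z ^ (s + 1)) z v = (s + 1) * f z ^ s * fderiv ℝ f z v := by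
  have h := ((hf.differentiable one_ne_zero) z).hasFDerivAt.pow (s + 1)
  rw [h.fderiv]
  simp

/-- The squared `H¹` norm of a smooth function on a rectangle. -/
def smoothEnergy (f : ℝ × ℝ → ℂ) (S : Set (ℝ × ℝ)) : ℝ≥0∞ :=
  ∫⁻ z in S, (‖f z‖ₑ ^ 2 + ‖fderiv ℝ f z (1, 0)‖ₑ ^ 2 + ‖fderiv ℝ f z (0, 1)‖ₑ ^ 2)

/-- Apply the W^{1,1} inequality to f^{s+1}. Both factors contain |f|^s times |f| or a partial
derivative, so Cauchy–Schwarz bounds each by a multiple of the square root of J N. The integrability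
exponent thus climbs from 2s to 2(s + 1). -/
theorem sobolev_step_smooth (hf : ContDiff ℝ 1 f) (a b c d : ℝ) (s : ℕ) :
    ENNReal.ofReal (b - a) * ENNReal.ofReal (d - c) *
      ∫⁻ z in rect a b c d, ‖f z‖ₑ ^ (2 * (s + 1)) ≤
    (1 + ENNReal.ofReal (b - a) * (s + 1)) * (1 + ENNReal.ofReal (d - c) * (s + 1)) *
      ((∫⁻ z in rect a b c d, ‖f z‖ₑ ^ (2 * s)) * smoothEnergy f (rect a b c d)) := by
  have cx := continuous_fderiv_dir hf (1, 0)
  have cy := continuous_fderiv_dir hf (0, 1)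
  have cf := hf.continuous
  set A := ENNReal.ofReal (b - a) with hA
  set B := ENNReal.ofReal (d - c) with hB
  set J := ∫⁻ z in rect a b c d, ‖f z‖ₑ ^ (2 * s) with hJ
  set N := smoothEnergy f (rect a b c d) with hN
  have hL := ladyzhenskaya_smooth (hf.pow (s + 1)) a b c d
  simp only [fderiv_pow_apply hf] at hL
  have cs : ∀ h : ℝ × ℝ → ℂ, Continuous h →
      (∀ z, ‖h z‖ₑ ^ 2 ≤ ‖f z‖ₑ ^ 2 + ‖fderiv ℝ f z (1, 0)‖ₑ ^ 2 + ‖fderiv ℝ f z (0, 1)‖ₑ ^ 2) →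
      ∫⁻ z in rect a b c d, ‖f z‖ₑ ^ s * ‖h z‖ₑ ≤ (J * N) ^ (1 / 2 : ℝ) := by
    intro h hc hle
    have h1 := sq_lintegral_mul_le (μ := volume.restrict (rect a b c d))
      (f := fun z => ‖f z‖ₑ ^ s) (g := fun z => ‖h z‖ₑ) (by fun_prop) (by fun_prop)
    have h2 : ∫⁻ z in rect a b c d, ‖h z‖ₑ ^ 2 ≤ N := lintegral_mono hle
    have h3 : ∀ z, (‖f z‖ₑ ^ s) ^ 2 = ‖f z‖ₑ ^ (2 * s) := fun z => by rw [← pow_mul, mul_comm]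
    simp only [h3] at h1
    rw [one_div, ENNReal.le_rpow_inv_iff (by norm_num), ENNReal.rpow_two]
    exact h1.trans (by gcongr)
  have key : ∀ (C : ℝ≥0∞) (v : ℝ × ℝ), (∀ z, ‖fderiv ℝ f z v‖ₑ ^ 2 ≤
      ‖f z‖ₑ ^ 2 + ‖fderiv ℝ f z (1, 0)‖ₑ ^ 2 + ‖fderiv ℝ f z (0, 1)‖ₑ ^ 2) →
      ∫⁻ z in rect a b c d, (‖f z ^ (s + 1)‖ₑ + C * ‖(s + 1) * f z ^ s * fderiv ℝ f z v‖ₑ) ≤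
      (1 + C * (s + 1)) * (J * N) ^ (1 / 2 : ℝ) := by
    intro C v hv
    have cv := continuous_fderiv_dir hf v
    have e : ∀ z, ‖f z ^ (s + 1)‖ₑ + C * ‖(s + 1) * f z ^ s * fderiv ℝ f z v‖ₑ =
        ‖f z‖ₑ ^ s * ‖f z‖ₑ + C * (s + 1) * (‖f z‖ₑ ^ s * ‖fderiv ℝ f z v‖ₑ) := fun z => by
      have : ‖((s : ℂ) + 1)‖ₑ = s + 1 := by
        have : ((s : ℂ) + 1) = ((s + 1 : ℕ) : ℂ) := by push_cast; rfl
        rw [this, ← ofReal_norm, Complex.norm_natCast, ENNReal.ofReal_natCast]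
        push_cast; rfl
      rw [enorm_mul, enorm_mul, enorm_pow, enorm_pow, this]
      ring
    simp only [e]
    rw [lintegral_add_left (by fun_prop), lintegral_const_mul _ (by fun_prop), add_mul, one_mul]
    gcongr
    · exact cs f cf fun z => by rw [add_assoc]; exact le_self_add
    · exact cs _ cv hv
  have e2 : ∀ z, ‖f z ^ (s + 1)‖ₑ ^ 2 = ‖f z‖ₑ ^ (2 * (s + 1)) := fun z => by
    rw [enorm_pow, ← pow_mul, mul_comm]
  simp only [e2] at hL
  refine hL.trans ((mul_le_mul' (key A (1, 0) fun z => ?_) (key B (0, 1) fun z => ?_)).trans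
    (le_of_eq ?_))
  · rw [add_right_comm]; exact le_add_self
  · exact le_add_self
  · rw [mul_mul_mul_comm, ← ENNReal.rpow_add_of_nonneg _ _ (by norm_num) (by norm_num)]
    norm_num

end Smooth

/-- The constant in the iterated Sobolev inequality on rectangles of sides about `A` and `B`. -/
def sobolevConst (A B : ℝ≥0∞) : ℕ → ℝ≥0∞
  | 0 => 1
  | s + 1 => sobolevConst A B s *
      ((1 + A * ((s + 1 : ℕ) + 1)) * (1 + B * ((s + 1 : ℕ) + 1)) * (4 * (A * B)⁻¹))

theorem sobolevConst_ne_top {A B : ℝ≥0∞} (hA : A ≠ 0) (hB : B ≠ 0) (hA' : A ≠ ⊤) (hB' : B ≠ ⊤)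
    (s : ℕ) : sobolevConst A B s ≠ ⊤ := by
  induction s with
  | zero => simp [sobolevConst]
  | succ s ih =>
    rw [sobolevConst]
    refine ENNReal.mul_ne_top ih (ENNReal.mul_ne_top (ENNReal.mul_ne_top ?_ ?_)
      (ENNReal.mul_ne_top (by norm_num) ?_))
    · exact ENNReal.add_ne_top.2 ⟨by norm_num, ENNReal.mul_ne_top hA' (by finiteness)⟩
    · exact ENNReal.add_ne_top.2 ⟨by norm_num, ENNReal.mul_ne_top hB' (by finiteness)⟩
    · exact ENNReal.inv_ne_top.2 (mul_ne_zero hA hB)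

/-- The constant is uniform while the sides range over [A/2, A] and [B/2, B]: mollifications are
controlled only on slightly smaller rectangles, whose sides vary with n. The factor 4 in
`sobolevConst` pays for the two possible halvings. -/
theorem sobolev_smooth {f : ℝ × ℝ → ℂ} (hf : ContDiff ℝ 1 f) {A B : ℝ} (hA : 0 < A) (hB : 0 < B)
    {a b c d : ℝ} (h1 : A / 2 ≤ b - a) (h2 : b - a ≤ A) (h3 : B / 2 ≤ d - c) (h4 : d - c ≤ B)
    (s : ℕ) :
    ∫⁻ z in rect a b c d, ‖f z‖ₑ ^ (2 * (s + 1)) ≤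
      sobolevConst (ENNReal.ofReal A) (ENNReal.ofReal B) s *
        smoothEnergy f (rect a b c d) ^ (s + 1) := by
  induction s with
  | zero =>
    simp only [sobolevConst, zero_add, pow_one, one_mul, mul_one]
    exact lintegral_mono fun z => by rw [add_assoc]; exact le_self_add
  | succ s ih =>
    have hs := sobolev_step_smooth hf a b c d (s + 1)
    set J := ∫⁻ z in rect a b c d, ‖f z‖ₑ ^ (2 * (s + 1 + 1))
    set N := smoothEnergy f (rect a b c d)
    set A' := ENNReal.ofReal A with hA'
    set B' := ENNReal.ofReal B with hB'
    have p1 : A' ≤ 2 * ENNReal.ofReal (b - a) := by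
      rw [hA', ← ENNReal.ofReal_ofNat, ← ENNReal.ofReal_mul (by norm_num)]
      exact ENNReal.ofReal_le_ofReal (by linarith)
    have p2 : B' ≤ 2 * ENNReal.ofReal (d - c) := by
      rw [hB', ← ENNReal.ofReal_ofNat, ← ENNReal.ofReal_mul (by norm_num)]
      exact ENNReal.ofReal_le_ofReal (by linarith)
    have q1 : ENNReal.ofReal (b - a) ≤ A' := ENNReal.ofReal_le_ofReal h2
    have q2 : ENNReal.ofReal (d - c) ≤ B' := ENNReal.ofReal_le_ofReal h4
    have hAB : A' * B' ≠ 0 := by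
      simp [hA', hB', hA, hB]
    have hAB' : A' * B' ≠ ⊤ := by finiteness
    have key : A' * B' * J ≤ 4 * ((1 + A' * ((s + 1 : ℕ) + 1)) * (1 + B' * ((s + 1 : ℕ) + 1)) *
        ((sobolevConst A' B' s * N ^ (s + 1)) * N)) :=
      calc A' * B' * J ≤ (2 * ENNReal.ofReal (b - a)) * (2 * ENNReal.ofReal (d - c)) * J := by
            gcongr
        _ = 4 * (ENNReal.ofReal (b - a) * ENNReal.ofReal (d - c) * J) := by ring
        _ ≤ _ := by
            refine mul_le_mul_right (hs.trans ?_) 4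
            gcongr
    calc J = (A' * B')⁻¹ * (A' * B' * J) := by
          rw [← mul_assoc, ENNReal.inv_mul_cancel hAB hAB', one_mul]
      _ ≤ (A' * B')⁻¹ * _ := mul_le_mul_right key _
      _ = _ := by rw [sobolevConst]; ring

/-! ### Translations and difference quotients of C¹ functions -/

theorem setLIntegral_add_le {K K' : Set (ℝ × ℝ)} (hK : MeasurableSet K) (hK' : MeasurableSet K')
    {w : ℝ × ℝ} (h : ∀ z ∈ K, z + w ∈ K') (F : ℝ × ℝ → ℝ≥0∞) :
    ∫⁻ z in K, F (z + w) ≤ ∫⁻ z in K', F z := by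
  rw [← lintegral_indicator hK', ← lintegral_indicator hK,
    ← lintegral_add_right_eq_self (K'.indicator F) w]
  refine lintegral_mono fun z => ?_
  by_cases hz : z ∈ K
  · simp [hz, h z hz]
  · simp [hz]

/-- Integrate the derivative along the segment from z to z + h v, apply Cauchy–Schwarz, and exchange
the integrals; each translate of K by t v stays in K'. -/
theorem difference_smooth {f : ℝ × ℝ → ℂ} (hf : ContDiff ℝ 1 f) {K K' : Set (ℝ × ℝ)}
    (hK : MeasurableSet K) (hK' : MeasurableSet K') {h : ℝ} (hh : 0 ≤ h) {v : ℝ × ℝ}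
    (hKK' : ∀ z ∈ K, ∀ t ∈ Icc 0 h, z + t • v ∈ K') :
    ∫⁻ z in K, ‖f (z + h • v) - f z‖ₑ ^ 2 ≤
      ENNReal.ofReal h ^ 2 * ∫⁻ z in K', ‖fderiv ℝ f z v‖ₑ ^ 2 := by
  have cv := continuous_fderiv_dir hf v
  have hd : ∀ z t, HasDerivAt (fun t : ℝ => f (z + t • v)) (fderiv ℝ f (z + t • v) v) t := by
    intro z t
    have h := ((hf.differentiable one_ne_zero) (z + t • v)).hasFDerivAt
    have := h.comp_hasDerivAt t (((hasDerivAt_id t).smul_const v).const_add z)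
    simpa [Function.comp_def] using this
  calc ∫⁻ z in K, ‖f (z + h • v) - f z‖ₑ ^ 2
      ≤ ∫⁻ z in K, ENNReal.ofReal h * ∫⁻ t in Icc 0 h, ‖fderiv ℝ f (z + t • v) v‖ₑ ^ 2 := by
        refine lintegral_mono fun z => ?_
        have := enorm_sub_sq_le_lintegral_deriv (hd z)
          (cv.comp (by fun_prop : Continuous fun t : ℝ => z + t • v))
          (a := 0) (b := h) (s := h) (t := 0) ⟨hh, le_rfl⟩ ⟨le_rfl, hh⟩
        simpa using this
    _ = ENNReal.ofReal h * ∫⁻ t in Icc 0 h, ∫⁻ z in K, ‖fderiv ℝ f (z + t • v) v‖ₑ ^ 2 := by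
        have cc : Continuous fun q : (ℝ × ℝ) × ℝ => fderiv ℝ f (q.1 + q.2 • v) v :=
          cv.comp (by fun_prop)
        rw [lintegral_const_mul']
        · congr 1
          exact lintegral_lintegral_swap (by
            exact (cc.measurable.enorm.pow_const 2).aemeasurable)
        · finiteness
    _ ≤ ENNReal.ofReal h * ∫⁻ t in Icc 0 h, ∫⁻ z in K', ‖fderiv ℝ f z v‖ₑ ^ 2 := by
        refine mul_le_mul_right ?_ _
        refine setLIntegral_mono' measurableSet_Icc fun t ht => ?_
        exact setLIntegral_add_le hK hK' (fun z hz => hKK' z hz t ht)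
          (fun z => ‖fderiv ℝ f z v‖ₑ ^ 2)
    _ = _ := by simp; ring

/-! ### Mollification -/

/-- Fatou's lemma in the form by which the estimates for smooth functions are transferred to H¹. -/
theorem lintegral_le_of_ae_tendsto {α : Type*} [MeasurableSpace α] {μ : Measure α}
    {F : ℕ → α → ℝ≥0∞} {G : α → ℝ≥0∞} {C : ℝ≥0∞} (hF : ∀ n, AEMeasurable (F n) μ)
    (h : ∀ᵐ a ∂μ, Tendsto (fun n => F n a) atTop (𝓝 (G a)))
    (hC : ∀ᶠ n in atTop, ∫⁻ a, F n a ∂μ ≤ C) : ∫⁻ a, G a ∂μ ≤ C := by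
  calc ∫⁻ a, G a ∂μ = ∫⁻ a, liminf (fun n => F n a) atTop ∂μ :=
        lintegral_congr_ae (h.mono fun a ha => ha.liminf_eq.symm)
    _ ≤ liminf (fun n => ∫⁻ a, F n a ∂μ) atTop := lintegral_liminf_le' hF
    _ ≤ C := liminf_le_of_frequently_le' hC.frequently

/-- The radius of the `n`-th mollifier. -/
def mollRadius (n : ℕ) : ℝ := 1 / ((n : ℝ) + 1)

theorem mollRadius_pos (n : ℕ) : 0 < mollRadius n := by unfold mollRadius; positivity

theorem tendsto_mollRadius : Tendsto mollRadius atTop (𝓝 0) :=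
  tendsto_one_div_add_atTop_nhds_zero_nat

/-- The `n`-th mollifier. -/
def mollifier (n : ℕ) : ContDiffBump (0 : ℝ × ℝ) where
  rIn := mollRadius n / 2
  rOut := mollRadius n
  rIn_pos := half_pos (mollRadius_pos n)
  rIn_lt_rOut := half_lt_self (mollRadius_pos n)

/-- The `n`-th mollification of a function. -/
def mollify (n : ℕ) (g : ℝ × ℝ → ℂ) : ℝ × ℝ → ℂ :=
  (mollifier n).normed volume ⋆[ContinuousLinearMap.lsmul ℝ ℝ, volume] g

theorem mollify_apply (n : ℕ) (g : ℝ × ℝ → ℂ) (z : ℝ × ℝ) :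
    mollify n g z = ∫ t, (mollifier n).normed volume t • g (z - t) := rfl

theorem contDiff_mollify {g : ℝ × ℝ → ℂ} (hg : LocallyIntegrable g) (n : ℕ) :
    ContDiff ℝ 1 (mollify n g) :=
  (mollifier n).hasCompactSupport_normed.contDiff_convolution_left _
    (mollifier n).contDiff_normed hg

theorem ae_tendsto_mollify {g : ℝ × ℝ → ℂ} (hg : LocallyIntegrable g) :
    ∀ᵐ z, Tendsto (fun n => mollify n g z) atTop (𝓝 (g z)) :=
  ContDiffBump.ae_convolution_tendsto_right_of_locallyIntegrable (K := 2) tendsto_mollRadius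
    (Eventually.of_forall fun n => by simp [mollifier]; linarith) hg

/-- Mollifying is averaging translates of g against a probability measure ν carried by a ball, so
|average|² ≤ average of squares, and Tonelli finishes. Measurability of g gives the joint
measurability for Tonelli; the a.e. version goes through a representative. -/
theorem lintegral_mollify_le_of_measurable {g : ℝ × ℝ → ℂ} (hg : Measurable g) (n : ℕ)
    {K K' : Set (ℝ × ℝ)} (hK : MeasurableSet K) (hK' : MeasurableSet K')
    (hKK' : ∀ z ∈ K, Metric.closedBall z (mollRadius n) ⊆ K') :
    ∫⁻ z in K, ‖mollify n g z‖ₑ ^ 2 ≤ ∫⁻ z in K', ‖g z‖ₑ ^ 2 := by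
  set ρ : ℝ × ℝ → ℝ := (mollifier n).normed volume with hρ
  have cρ : Continuous ρ := (mollifier n).continuous_normed
  have ρ0 : ∀ t, 0 ≤ ρ t := (mollifier n).nonneg_normed
  set ν : Measure (ℝ × ℝ) := volume.withDensity fun t => ENNReal.ofReal (ρ t) with hν
  have mρ : Measurable fun t => ENNReal.ofReal (ρ t) := by fun_prop
  have hν1 : ν univ = 1 := by
    rw [hν, withDensity_apply _ MeasurableSet.univ, Measure.restrict_univ,
      ← ofReal_integral_eq_lintegral_ofReal (mollifier n).integrable_normed
        (Eventually.of_forall ρ0), (mollifier n).integral_normed, ENNReal.ofReal_one]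
  have : IsProbabilityMeasure ν := ⟨hν1⟩
  have hpt : ∀ z, ‖mollify n g z‖ₑ ^ 2 ≤ ∫⁻ t, ‖g (z - t)‖ₑ ^ 2 ∂ν := by
    intro z
    have m1 : Measurable fun t => ‖g (z - t)‖ₑ := (hg.comp (measurable_const.sub measurable_id)).enorm
    have h1 : ‖mollify n g z‖ₑ ≤ ∫⁻ t, ‖g (z - t)‖ₑ ∂ν := by
      rw [mollify_apply, hν, lintegral_withDensity_eq_lintegral_mul _ mρ m1]
      refine (enorm_integral_le_lintegral_enorm _).trans (le_of_eq ?_)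
      refine lintegral_congr fun t => ?_
      rw [enorm_smul, Pi.mul_apply, Real.enorm_eq_ofReal (ρ0 t)]
    refine (pow_le_pow_left' h1 2).trans ((sq_lintegral_le m1.aemeasurable).trans ?_)
    rw [hν1, one_mul]
  have hsupp : ∀ᵐ t ∂ν, t ∈ Metric.ball (0 : ℝ × ℝ) (mollRadius n) := by
    rw [hν, ae_withDensity_iff mρ]
    refine Eventually.of_forall fun t ht => ?_
    have : t ∈ Function.support ρ := fun h => ht (by simp [h])
    rwa [hρ, (mollifier n).support_normed_eq] at this
  calc ∫⁻ z in K, ‖mollify n g z‖ₑ ^ 2 ≤ ∫⁻ z in K, (∫⁻ t, ‖g (z - t)‖ₑ ^ 2 ∂ν) :=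
        lintegral_mono hpt
    _ = ∫⁻ t, (∫⁻ z in K, ‖g (z - t)‖ₑ ^ 2) ∂ν :=
        lintegral_lintegral_swap (by
          exact ((hg.comp (measurable_fst.sub measurable_snd)).enorm.pow_const 2).aemeasurable)
    _ ≤ ∫⁻ _, (∫⁻ z in K', ‖g z‖ₑ ^ 2) ∂ν := by
        refine lintegral_mono_ae (hsupp.mono fun t ht => ?_)
        have := setLIntegral_add_le hK hK' (w := -t) (fun z hz => hKK' z hz (by
          simpa [dist_eq_norm] using (mem_ball_zero_iff.1 ht).le)) (fun z => ‖g z‖ₑ ^ 2)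
        simpa [sub_eq_add_neg] using this
    _ = _ := by simp

theorem mollify_congr {g g' : ℝ × ℝ → ℂ} (h : g =ᵐ[volume] g') (n : ℕ) :
    mollify n g = mollify n g' := by
  ext z
  rw [mollify_apply, mollify_apply]
  refine integral_congr_ae ?_
  have := (quasiMeasurePreserving_sub_left_of_right_invariant volume z).ae_eq h
  filter_upwards [this] with t ht
  simp only [Function.comp] at ht
  rw [ht]

theorem lintegral_mollify_le {g : ℝ × ℝ → ℂ} (hg : AEStronglyMeasurable g volume) (n : ℕ)
    {K K' : Set (ℝ × ℝ)} (hK : MeasurableSet K) (hK' : MeasurableSet K')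
    (hKK' : ∀ z ∈ K, Metric.closedBall z (mollRadius n) ⊆ K') :
    ∫⁻ z in K, ‖mollify n g z‖ₑ ^ 2 ≤ ∫⁻ z in K', ‖g z‖ₑ ^ 2 := by
  rw [mollify_congr hg.ae_eq_mk n]
  refine (lintegral_mollify_le_of_measurable hg.stronglyMeasurable_mk.measurable n hK hK'
    hKK').trans (le_of_eq ?_)
  exact lintegral_congr_ae (ae_restrict_of_ae (hg.ae_eq_mk.mono fun z hz => by simp only [hz]))

theorem measurableSet_strip (L : ℝ) : MeasurableSet (strip L) :=
  MeasurableSet.univ.prod measurableSet_Icc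

theorem memLp_indicator_strip {L : ℝ} {u : ℝ × ℝ → ℂ}
    (hu : MemLp u 2 (volume.restrict (strip L))) : MemLp ((strip L).indicator u) 2 volume :=
  (memLp_indicator_iff_restrict (measurableSet_strip L)).2 hu

/-- The derivative falls on the kernel, and w ↦ ρ(z − w) is a test function because the ball around
z lies in the open strip. The sign from reflecting the kernel cancels the sign in the definition of
the weak derivative. -/
theorem fderiv_mollify {L : ℝ} {v : ℝ × ℝ} {u g : ℝ × ℝ → ℂ}
    (hu : MemLp u 2 (volume.restrict (strip L))) (hg : HasL2WeakDeriv L v u g) (n : ℕ)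
    {z : ℝ × ℝ} (hz : Metric.closedBall z (mollRadius n) ⊆ openStrip L) :
    fderiv ℝ (mollify n ((strip L).indicator u)) z v = mollify n ((strip L).indicator g) z := by
  set ρ : ℝ × ℝ → ℝ := (mollifier n).normed volume with hρ
  have hl : LocallyIntegrable ((strip L).indicator u) volume :=
    (memLp_indicator_strip hu).locallyIntegrable (by norm_num)
  have hs : ContDiff ℝ ((⊤ : ℕ∞) : WithTop ℕ∞) ρ := (mollifier n).contDiff_normed
  have hc : HasCompactSupport ρ := (mollifier n).hasCompactSupport_normed
  have hs1 : ContDiff ℝ 1 ρ := (mollifier n).contDiff_normed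
  have hd := hc.hasFDerivAt_convolution_left (ContinuousLinearMap.lsmul ℝ ℝ) hs1 hl z
  rw [mollify, hd.fderiv]
  have hφ : IsTestFunction L fun w => ρ (z - w) := by
    refine ⟨hs.comp (contDiff_const.sub contDiff_id), ?_, ?_⟩
    · exact hc.comp_homeomorph (Homeomorph.subLeft z)
    · refine Subset.trans ?_ hz
      refine closure_minimal (fun w hw => ?_) Metric.isClosed_closedBall
      have : z - w ∈ Function.support ρ := hw
      rw [hρ, (mollifier n).support_normed_eq] at this
      rw [Metric.mem_closedBall, dist_comm, dist_eq_norm]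
      exact (mem_ball_zero_iff.1 this).le
  have hφ' : ∀ w, fderiv ℝ (fun w => ρ (z - w)) w v = - fderiv ℝ ρ (z - w) v := by
    intro w
    have h1 : HasFDerivAt ρ (fderiv ℝ ρ (z - w)) (z - w) :=
      (hs1.differentiable one_ne_zero (z - w)).hasFDerivAt
    have h2 := h1.comp w ((hasFDerivAt_id w).const_sub z)
    rw [show (fun w => ρ (z - w)) = ρ ∘ fun w => z - w from rfl]
    have := h2.fderiv
    rw [this]
    simp
  have key := hg.integral_eq _ hφ
  simp only [hφ'] at key
  have hci : ConvolutionExistsAt (fderiv ℝ ρ) ((strip L).indicator u) z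
      (ContinuousLinearMap.precompL (ℝ × ℝ) (ContinuousLinearMap.lsmul ℝ ℝ)) volume :=
    (hc.fderiv ℝ).convolutionExists_left _ (hs1.continuous_fderiv one_ne_zero) hl z
  have e1 : (fderiv ℝ ρ ⋆[ContinuousLinearMap.precompL (ℝ × ℝ)
        (ContinuousLinearMap.lsmul ℝ ℝ), volume] (strip L).indicator u) z v
      = ∫ w in strip L, fderiv ℝ ρ (z - w) v • u w := by
    rw [convolution, ContinuousLinearMap.integral_apply hci, ← integral_indicator
      (measurableSet_strip L), ← integral_sub_left_eq_self _ volume z]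
    refine integral_congr_ae (Eventually.of_forall fun w => ?_)
    by_cases hw : w ∈ strip L <;> simp [hw, ContinuousLinearMap.precompL_apply]
  have e2 : mollify n ((strip L).indicator g) z = ∫ w in strip L, ρ (z - w) • g w := by
    rw [mollify_apply, ← integral_indicator (measurableSet_strip L),
      ← integral_sub_left_eq_self _ volume z]
    refine integral_congr_ae (Eventually.of_forall fun w => ?_)
    by_cases hw : w ∈ strip L <;> simp [hw, hρ]
  rw [e1, e2]
  simp only [neg_smul, integral_neg] at key
  exact neg_inj.1 key

/-! ### Transfer of the inequalities to H¹ of the strip -/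

/-- `u` is in `H¹` of the strip, with weak partial derivatives `g` and `h`. -/
structure SobolevTriple (L : ℝ) (u g h : ℝ × ℝ → ℂ) : Prop where
  memLp : MemLp u 2 (volume.restrict (strip L))
  dx : HasL2WeakDeriv L (1, 0) u g
  dy : HasL2WeakDeriv L (0, 1) u h

/-- The squared `H¹` norm on the set `S`, with values in `ℝ≥0∞`. -/
def tripleEnergy (u g h : ℝ × ℝ → ℂ) (S : Set (ℝ × ℝ)) : ℝ≥0∞ :=
  ∫⁻ z in S, (‖u z‖ₑ ^ 2 + ‖g z‖ₑ ^ 2 + ‖h z‖ₑ ^ 2)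

theorem rect_subset_strip {L a b c d : ℝ} (hc : 0 ≤ c) (hd : d ≤ L) :
    rect a b c d ⊆ strip L := fun _ hz => ⟨mem_univ _, hc.trans hz.2.1, hz.2.2.trans hd⟩

/-- The rectangle shrunk by twice the `n`-th mollification radius. -/
def innerRect (a b c d : ℝ) (n : ℕ) : Set (ℝ × ℝ) :=
  rect (a + 2 * mollRadius n) (b - 2 * mollRadius n) (c + 2 * mollRadius n) (d - 2 * mollRadius n)

theorem abs_le_of_mem_closedBall {z w : ℝ × ℝ} {r : ℝ} (h : w ∈ Metric.closedBall z r) :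
    |w.1 - z.1| ≤ r ∧ |w.2 - z.2| ≤ r := by
  rw [Metric.mem_closedBall, Prod.dist_eq, max_le_iff, Real.dist_eq, Real.dist_eq] at h
  exact h

theorem closedBall_subset_rect {a b c d : ℝ} {n : ℕ} {z : ℝ × ℝ} (hz : z ∈ innerRect a b c d n) :
    Metric.closedBall z (mollRadius n) ⊆ rect a b c d := by
  intro w hw
  have hr := mollRadius_pos n
  obtain ⟨h1, h2⟩ := abs_le_of_mem_closedBall hw
  obtain ⟨⟨h3, h4⟩, h5, h6⟩ := hz
  rw [abs_le] at h1 h2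
  exact ⟨⟨by linarith, by linarith⟩, by linarith, by linarith⟩

/-- The factor 2 in `innerRect` matters here: the rectangle may touch the edges of the strip, and a
margin of one radius would keep the closed ball only in the closed strip. -/
theorem closedBall_subset_openStrip {L a b c d : ℝ} (hc : 0 ≤ c) (hd : d ≤ L) {n : ℕ} {z : ℝ × ℝ}
    (hz : z ∈ innerRect a b c d n) : Metric.closedBall z (mollRadius n) ⊆ openStrip L := by
  intro w hw
  have hr := mollRadius_pos n
  obtain ⟨-, h2⟩ := abs_le_of_mem_closedBall hw
  obtain ⟨-, h5, h6⟩ := hz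
  rw [abs_le] at h2
  exact ⟨mem_univ _, by linarith, by linarith⟩

theorem lintegral_innerRect_mollify_le {L a b c d : ℝ} (hc : 0 ≤ c) (hd : d ≤ L) (n : ℕ)
    {u : ℝ × ℝ → ℂ} (hu : MemLp u 2 (volume.restrict (strip L))) :
    ∫⁻ z in innerRect a b c d n, ‖mollify n ((strip L).indicator u) z‖ₑ ^ 2 ≤
      ∫⁻ z in rect a b c d, ‖u z‖ₑ ^ 2 := by
  refine (lintegral_mollify_le (memLp_indicator_strip hu).1 n (measurableSet_rect _ _ _ _)
    (measurableSet_rect a b c d) fun z hz => closedBall_subset_rect hz).trans (le_of_eq ?_)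
  refine setLIntegral_congr_fun (measurableSet_rect _ _ _ _) fun z hz => ?_
  simp [rect_subset_strip hc hd hz]

theorem lintegral_innerRect_fderiv_le {L a b c d : ℝ} (hc : 0 ≤ c) (hd : d ≤ L) (n : ℕ)
    {u g : ℝ × ℝ → ℂ} {v : ℝ × ℝ} (hu : MemLp u 2 (volume.restrict (strip L)))
    (hg : HasL2WeakDeriv L v u g) :
    ∫⁻ z in innerRect a b c d n, ‖fderiv ℝ (mollify n ((strip L).indicator u)) z v‖ₑ ^ 2 ≤
      ∫⁻ z in rect a b c d, ‖g z‖ₑ ^ 2 := by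
  refine le_trans (le_of_eq ?_) (lintegral_innerRect_mollify_le hc hd n hg.memLp)
  refine setLIntegral_congr_fun (measurableSet_rect _ _ _ _) fun z hz => ?_
  simp only [fderiv_mollify hu hg n (closedBall_subset_openStrip hc hd hz)]

theorem contDiff_mollify_strip {L : ℝ} {u : ℝ × ℝ → ℂ}
    (hu : MemLp u 2 (volume.restrict (strip L))) (n : ℕ) :
    ContDiff ℝ 1 (mollify n ((strip L).indicator u)) :=
  contDiff_mollify ((memLp_indicator_strip hu).locallyIntegrable (by norm_num)) n

theorem SobolevTriple.smoothEnergy_mollify_le {L a b c d : ℝ} {u g h : ℝ × ℝ → ℂ}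
    (H : SobolevTriple L u g h) (hc : 0 ≤ c) (hd : d ≤ L) (n : ℕ) :
    smoothEnergy (mollify n ((strip L).indicator u)) (innerRect a b c d n) ≤
      tripleEnergy u g h (rect a b c d) := by
  have cf := contDiff_mollify_strip H.memLp n
  have c0 := cf.continuous
  have cx := continuous_fderiv_dir cf (1, 0)
  have cy := continuous_fderiv_dir cf (0, 1)
  rw [smoothEnergy, lintegral_add_left (by fun_prop), lintegral_add_left (by fun_prop)]
  refine le_trans ?_ ((add_le_add_left (le_lintegral_add _ _) _).trans (le_lintegral_add _ _))
  exact add_le_add (add_le_add (lintegral_innerRect_mollify_le hc hd n H.memLp)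
    (lintegral_innerRect_fderiv_le hc hd n H.memLp H.dx))
    (lintegral_innerRect_fderiv_le hc hd n H.memLp H.dy)

theorem ae_tendsto_mollify_strip {L : ℝ} {u : ℝ × ℝ → ℂ}
    (hu : MemLp u 2 (volume.restrict (strip L))) {S : Set (ℝ × ℝ)} (hS : S ⊆ strip L)
    (hSm : MeasurableSet S) :
    ∀ᵐ z ∂(volume.restrict S),
      Tendsto (fun n => mollify n ((strip L).indicator u) z) atTop (𝓝 (u z)) := by
  have := ae_tendsto_mollify ((memLp_indicator_strip hu).locallyIntegrable (by norm_num))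
  filter_upwards [ae_restrict_of_ae this, ae_restrict_mem hSm] with z hz hzS
  simpa [hS hzS] using hz

theorem ae_eventually_mem_innerRect (a b c d : ℝ) :
    ∀ᵐ z ∂(volume.restrict (rect a b c d)), ∀ᶠ n in atTop, z ∈ innerRect a b c d n := by
  have e : (rect a b c d : Set (ℝ × ℝ)) =ᵐ[volume] Ioo a b ×ˢ Ioo c d :=
    Measure.set_prod_ae_eq Ioo_ae_eq_Icc.symm Ioo_ae_eq_Icc.symm
  rw [Measure.restrict_congr_set e]
  filter_upwards [ae_restrict_mem (measurableSet_Ioo.prod measurableSet_Ioo)] with z hz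
  obtain ⟨⟨h1, h2⟩, h3, h4⟩ := hz
  have ht : Tendsto (fun n => 2 * mollRadius n) atTop (𝓝 0) := by
    simpa using tendsto_mollRadius.const_mul 2
  filter_upwards [ht.eventually_lt_const (sub_pos.2 h1), ht.eventually_lt_const (sub_pos.2 h2),
    ht.eventually_lt_const (sub_pos.2 h3), ht.eventually_lt_const (sub_pos.2 h4)] with n e1 e2 e3 e4
  exact ⟨⟨by linarith, by linarith⟩, by linarith, by linarith⟩

theorem innerRect_subset (a b c d : ℝ) (n : ℕ) : innerRect a b c d n ⊆ rect a b c d := fun _ hz =>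
  closedBall_subset_rect hz (Metric.mem_closedBall_self (mollRadius_pos n).le)

theorem measurableSet_innerRect (a b c d : ℝ) (n : ℕ) : MeasurableSet (innerRect a b c d n) :=
  measurableSet_rect _ _ _ _

theorem setLIntegral_innerRect (a b c d : ℝ) (n : ℕ) (F : ℝ × ℝ → ℝ≥0∞) :
    ∫⁻ z in innerRect a b c d n, F z =
      ∫⁻ z in rect a b c d, (innerRect a b c d n).indicator F z := by
  rw [lintegral_indicator (measurableSet_innerRect _ _ _ _ _), Measure.restrict_restrict
    (measurableSet_innerRect _ _ _ _ _)]
  congr 2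
  exact (inter_eq_left.2 (innerRect_subset a b c d n)).symm

theorem SobolevTriple.sobolev {L : ℝ} {u g h : ℝ × ℝ → ℂ} (H : SobolevTriple L u g h)
    {a b c d : ℝ} (hab : a < b) (hcd : c < d) (hc : 0 ≤ c) (hd : d ≤ L) (s : ℕ) :
    ∫⁻ z in rect a b c d, ‖u z‖ₑ ^ (2 * (s + 1)) ≤
      sobolevConst (ENNReal.ofReal (b - a)) (ENNReal.ofReal (d - c)) s *
        tripleEnergy u g h (rect a b c d) ^ (s + 1) := by
  have cf := contDiff_mollify_strip H.memLp
  refine lintegral_le_of_ae_tendsto (F := fun n => (innerRect a b c d n).indicator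
    fun z => ‖mollify n ((strip L).indicator u) z‖ₑ ^ (2 * (s + 1))) (fun n => ?_) ?_ ?_
  · have := (cf n).continuous
    exact ((by fun_prop : Measurable _).indicator (measurableSet_rect _ _ _ _)).aemeasurable
  · filter_upwards [ae_tendsto_mollify_strip H.memLp (rect_subset_strip hc hd)
      (measurableSet_rect a b c d), ae_eventually_mem_innerRect a b c d] with z h1 h2
    have h3 : Tendsto (fun n => ‖mollify n ((strip L).indicator u) z‖ₑ ^ (2 * (s + 1))) atTop
        (𝓝 (‖u z‖ₑ ^ (2 * (s + 1)))) :=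
      ((ENNReal.continuous_pow _).comp continuous_enorm).continuousAt.tendsto.comp h1
    exact h3.congr' (h2.mono fun n hn => by simp [hn])
  -- Shrinking removes four radii from each side; once this is less than half of the side, the
  -- uniform constant of `sobolev_smooth` applies.
  · have ht : Tendsto (fun n => 4 * mollRadius n) atTop (𝓝 0) := by
      simpa using tendsto_mollRadius.const_mul 4
    have hab' : 0 < (b - a) / 2 := by linarith
    have hcd' : 0 < (d - c) / 2 := by linarith
    filter_upwards [ht.eventually_lt_const hab', ht.eventually_lt_const hcd'] with n h1 h2
    have hr := mollRadius_pos n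
    rw [← setLIntegral_innerRect]
    refine (sobolev_smooth (cf n) (sub_pos.2 hab) (sub_pos.2 hcd) (by linarith) (by linarith)
      (by linarith) (by linarith) s).trans ?_
    gcongr
    exact H.smoothEnergy_mollify_le hc hd n

theorem SobolevTriple.poincare {L : ℝ} {u g h : ℝ × ℝ → ℂ} (H : SobolevTriple L u g h)
    {a b c d : ℝ} (hc : 0 ≤ c) (hd : d ≤ L) :
    ∫⁻ q, ‖u q.1 - u q.2‖ₑ ^ 2 ∂((volume.restrict (rect a b c d)).prod
      (volume.restrict (rect a b c d))) ≤
      2 * (ENNReal.ofReal (b - a) * ENNReal.ofReal (d - c)) *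
        (ENNReal.ofReal (b - a) ^ 2 * (∫⁻ z in rect a b c d, ‖g z‖ₑ ^ 2) +
         ENNReal.ofReal (d - c) ^ 2 * ∫⁻ z in rect a b c d, ‖h z‖ₑ ^ 2) := by
  have cf := contDiff_mollify_strip H.memLp
  set μ := (volume : Measure (ℝ × ℝ)).restrict (rect a b c d) with hμ
  set f := fun n => mollify n ((strip L).indicator u) with hf
  have hae : ∀ᵐ z ∂μ, Tendsto (fun n => f n z) atTop (𝓝 (u z)) ∧
      ∀ᶠ n in atTop, z ∈ innerRect a b c d n :=
    (ae_tendsto_mollify_strip H.memLp (rect_subset_strip hc hd)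
      (measurableSet_rect a b c d)).and (ae_eventually_mem_innerRect a b c d)
  have hm : ∀ n, MeasurableSet (innerRect a b c d n ×ˢ innerRect a b c d n) := fun n =>
    (measurableSet_rect _ _ _ _).prod (measurableSet_rect _ _ _ _)
  have hmeas : ∀ n, Measurable fun q : (ℝ × ℝ) × (ℝ × ℝ) => ‖f n q.1 - f n q.2‖ₑ ^ 2 := fun n => by
    have := (cf n).continuous
    simp only [hf]
    fun_prop
  refine lintegral_le_of_ae_tendsto (F := fun n => (innerRect a b c d n ×ˢ
    innerRect a b c d n).indicator fun q => ‖f n q.1 - f n q.2‖ₑ ^ 2) (fun n => ?_) ?_ ?_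
  · exact ((hmeas n).indicator (hm n)).aemeasurable
  · filter_upwards [Measure.quasiMeasurePreserving_fst.ae hae,
      Measure.quasiMeasurePreserving_snd.ae hae] with q h1 h2
    have h3 : Tendsto (fun n => ‖f n q.1 - f n q.2‖ₑ ^ 2) atTop (𝓝 (‖u q.1 - u q.2‖ₑ ^ 2)) :=
      ((ENNReal.continuous_pow 2).comp continuous_enorm).continuousAt.tendsto.comp
        (h1.1.sub h2.1)
    refine h3.congr' ?_
    filter_upwards [h1.2, h2.2] with n e1 e2
    rw [indicator_of_mem (mk_mem_prod e1 e2)]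
  · refine Eventually.of_forall fun n => ?_
    have hr := mollRadius_pos n
    have hi : μ.restrict (innerRect a b c d n) = volume.restrict (innerRect a b c d n) := by
      rw [hμ, Measure.restrict_restrict (measurableSet_innerRect _ _ _ _ _),
        inter_eq_left.2 (innerRect_subset a b c d n)]
    rw [lintegral_indicator (hm n), ← Measure.prod_restrict, hi,
      lintegral_prod _ (hmeas n).aemeasurable]
    refine (poincare_smooth (cf n) _ _ _ _).trans ?_
    have p1 := lintegral_innerRect_fderiv_le (a := a) (b := b) hc hd n H.memLp H.dx
    have p2 := lintegral_innerRect_fderiv_le (a := a) (b := b) hc hd n H.memLp H.dy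
    have l1 : ENNReal.ofReal (b - 2 * mollRadius n - (a + 2 * mollRadius n)) ≤
        ENNReal.ofReal (b - a) := ENNReal.ofReal_le_ofReal (by linarith)
    have l2 : ENNReal.ofReal (d - 2 * mollRadius n - (c + 2 * mollRadius n)) ≤
        ENNReal.ofReal (d - c) := ENNReal.ofReal_le_ofReal (by linarith)
    exact mul_le_mul' (mul_le_mul' le_rfl (mul_le_mul' l1 l2)) (add_le_add
      (mul_le_mul' (pow_le_pow_left' l1 2) p1) (mul_le_mul' (pow_le_pow_left' l2 2) p2))

/-- The strip shrunk by `r` on both sides. -/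
def innerStrip (L r : ℝ) : Set (ℝ × ℝ) := univ ×ˢ Icc r (L - r)

theorem measurableSet_innerStrip (L r : ℝ) : MeasurableSet (innerStrip L r) :=
  MeasurableSet.univ.prod measurableSet_Icc

/-- The margin 3r is spent in stages: r for the displacement t v, r for the mollification radius,
and the last r keeps closed balls inside the open strip. -/
theorem HasL2WeakDeriv.difference_le {L : ℝ} {v : ℝ × ℝ} {u g : ℝ × ℝ → ℂ}
    (hu : MemLp u 2 (volume.restrict (strip L))) (hg : HasL2WeakDeriv L v u g) {r t : ℝ}
    (hr : 0 < r) (ht : 0 ≤ t) (htr : t * ‖v‖ ≤ r) :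
    ∫⁻ z in innerStrip L (3 * r), ‖u (z + t • v) - u z‖ₑ ^ 2 ≤
      ENNReal.ofReal t ^ 2 * ∫⁻ z in strip L, ‖g z‖ₑ ^ 2 := by
  have cf := contDiff_mollify_strip hu
  set f := fun n => mollify n ((strip L).indicator u) with hf
  have hmem : ∀ z ∈ innerStrip L (3 * r), ∀ s ∈ Icc 0 t, z + s • v ∈ innerStrip L (2 * r) := by
    intro z hz s hs
    have h1 : |s * v.2| ≤ r := by
      rw [abs_mul, abs_of_nonneg hs.1]
      exact (mul_le_mul hs.2 (norm_snd_le v) (abs_nonneg _) ht).trans htr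
    rw [abs_le] at h1
    obtain ⟨-, h2, h3⟩ := hz
    refine ⟨mem_univ _, ?_, ?_⟩ <;> simp <;> linarith
  have hball : ∀ n, mollRadius n ≤ r → ∀ z ∈ innerStrip L (2 * r),
      Metric.closedBall z (mollRadius n) ⊆ openStrip L := by
    intro n hn z hz w hw
    obtain ⟨-, h2⟩ := abs_le_of_mem_closedBall hw
    obtain ⟨-, h5, h6⟩ := hz
    rw [abs_le] at h2
    exact ⟨mem_univ _, by linarith, by linarith⟩
  have hsub : ∀ ρ : ℝ, 0 < ρ → innerStrip L ρ ⊆ strip L := fun ρ hρ z hz =>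
    ⟨mem_univ _, by have := hz.2.1; linarith, by have := hz.2.2; linarith⟩
  have hall := ae_tendsto_mollify ((memLp_indicator_strip hu).locallyIntegrable (by norm_num))
  have hall' := (measurePreserving_add_right volume (t • v)).quasiMeasurePreserving.ae hall
  refine lintegral_le_of_ae_tendsto (F := fun n z => ‖f n (z + t • v) - f n z‖ₑ ^ 2)
    (fun n => ?_) ?_ ?_
  · have := (cf n).continuous
    simp only [hf]
    exact (by fun_prop : Measurable _).aemeasurable
  · filter_upwards [ae_restrict_of_ae hall, ae_restrict_of_ae hall',
      ae_restrict_mem (measurableSet_innerStrip L (3 * r))] with z h1 h2 hz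
    rw [indicator_of_mem (hsub _ (by linarith) hz)] at h1
    rw [indicator_of_mem (hsub _ (by linarith) (hmem z hz t ⟨ht, le_rfl⟩))] at h2
    exact ((ENNReal.continuous_pow 2).comp continuous_enorm).continuousAt.tendsto.comp
        (h2.sub h1)
  · filter_upwards [tendsto_mollRadius.eventually_le_const hr] with n hn
    refine (difference_smooth (cf n) (measurableSet_innerStrip _ _)
      (measurableSet_innerStrip _ _) ht hmem).trans ?_
    refine mul_le_mul_right ?_ _
    calc _ = ∫⁻ z in innerStrip L (2 * r), ‖mollify n ((strip L).indicator g) z‖ₑ ^ 2 := by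
          refine setLIntegral_congr_fun (measurableSet_innerStrip _ _) fun z hz => ?_
          simp only [fderiv_mollify hu hg n (hball n hn z hz)]
      _ ≤ ∫⁻ z in strip L, ‖(strip L).indicator g z‖ₑ ^ 2 :=
          lintegral_mollify_le (memLp_indicator_strip hg.memLp).1 n (measurableSet_innerStrip _ _)
            (measurableSet_strip L) fun z hz => (hball n hn z hz).trans fun w hw =>
              ⟨mem_univ _, hw.2.1.le, hw.2.2.le⟩
      _ = _ := by
          refine setLIntegral_congr_fun (measurableSet_strip _) fun z hz => ?_
          simp [hz]

/-! ### Weak convergence in L² -/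

/-- Banach–Alaoglu read along an ultrafilter: bounded families converge weakly with no extraction of
subsequences and no separability. The Riesz isometry turns the limiting functional back into a
vector. -/
theorem exists_weak_limit {E ι : Type*} [NormedAddCommGroup E] [InnerProductSpace ℂ E]
    [CompleteSpace E] (U : Ultrafilter ι) (x : ι → E) {C : ℝ} (hx : ∀ i, ‖x i‖ ≤ C) :
    ∃ a : E, ‖a‖ ≤ C ∧ ∀ e, Tendsto (fun i => inner ℂ (x i) e) U (𝓝 (inner ℂ a e)) := by
  let y : ι → WeakDual ℂ E := fun i =>
    StrongDual.toWeakDual (InnerProductSpace.toDual ℂ E (x i))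
  have hc := WeakDual.isCompact_closedBall (𝕜 := ℂ) (E := E) 0 C
  have hmem : ∀ i, y i ∈ WeakDual.toStrongDual ⁻¹' Metric.closedBall (0 : StrongDual ℂ E) C := by
    intro i
    simp only [mem_preimage, mem_closedBall_zero_iff]
    exact (LinearIsometryEquiv.norm_map (InnerProductSpace.toDual ℂ E) (x i)).trans_le (hx i)
  obtain ⟨φ, hφ, hlim⟩ := hc.ultrafilter_le_nhds (U.map y)
    (by rw [le_principal_iff]; exact Filter.mem_map.2 (Eventually.of_forall hmem))
  refine ⟨(InnerProductSpace.toDual ℂ E).symm (WeakDual.toStrongDual φ), ?_, fun e => ?_⟩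
  · rw [LinearIsometryEquiv.norm_map]
    simpa using hφ
  · rw [InnerProductSpace.toDual_symm_apply]
    have h1 : Tendsto y U (𝓝 φ) := hlim
    exact ((WeakDual.eval_continuous e).tendsto φ).comp h1

section Weak

variable {α ι : Type*} [MeasurableSpace α] {μ : Measure α}

/-- Weak convergence in `L²`, tested by integration. -/
def WeakTendsto (μ : Measure α) (x : ι → α → ℂ) (l : Filter ι) (a : α → ℂ) : Prop :=
  ∀ e, MemLp e 2 μ → Tendsto (fun i => ∫ z, e z * x i z ∂μ) l (𝓝 (∫ z, e z * a z ∂μ))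

theorem _root_.MeasureTheory.MemLp.integrable_norm_sq {u : α → ℂ} (hu : MemLp u 2 μ) :
    Integrable (fun z => ‖u z‖ ^ 2) μ :=
  (memLp_two_iff_integrable_sq_norm hu.1).1 hu

theorem memLp_conj {u : α → ℂ} (hu : MemLp u 2 μ) : MemLp (fun z => conj (u z)) 2 μ :=
  hu.star

theorem inner_toLp {u w : α → ℂ} (hu : MemLp u 2 μ) (hw : MemLp w 2 μ) :
    inner ℂ (hu.toLp u) (hw.toLp w) = ∫ z, conj (u z) * w z ∂μ := by
  rw [L2.inner_def]
  refine integral_congr_ae ?_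
  filter_upwards [hu.coeFn_toLp, hw.coeFn_toLp] with z h1 h2
  rw [h1, h2, RCLike.inner_apply, mul_comm]

theorem norm_toLp_sq {u : α → ℂ} (hu : MemLp u 2 μ) :
    ‖hu.toLp u‖ ^ 2 = ∫ z, ‖u z‖ ^ 2 ∂μ := by
  have h := inner_self_eq_norm_sq_to_K (𝕜 := ℂ) (hu.toLp u)
  rw [inner_toLp] at h
  have : ∀ z, conj (u z) * u z = ((‖u z‖ ^ 2 : ℝ) : ℂ) := fun z => by
    rw [mul_comm, Complex.mul_conj, Complex.normSq_eq_norm_sq]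
  simp only [this, integral_complex_ofReal] at h
  refine Complex.ofReal_injective ?_
  rw [h]
  push_cast
  rfl

theorem exists_weakTendsto (U : Ultrafilter ι) {x : ι → α → ℂ} (hx : ∀ i, MemLp (x i) 2 μ) {C : ℝ}
    (hC : ∀ i, ∫ z, ‖x i z‖ ^ 2 ∂μ ≤ C) :
    ∃ a, MemLp a 2 μ ∧ WeakTendsto μ x U a ∧ ∫ z, ‖a z‖ ^ 2 ∂μ ≤ C := by
  have h0 : ∀ i, ‖(hx i).toLp (x i)‖ ≤ √C := fun i =>
    Real.le_sqrt_of_sq_le (by rw [norm_toLp_sq]; exact hC i)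
  obtain ⟨a, ha, hlim⟩ := exists_weak_limit U _ h0
  refine ⟨a, Lp.memLp a, fun e he => ?_, ?_⟩
  · have h1 := (continuous_star.tendsto _).comp (hlim ((memLp_conj he).toLp _))
    have ea : a = (Lp.memLp a).toLp a := (Lp.toLp_coeFn a (Lp.memLp a)).symm
    rw [ea] at h1
    simp only [Function.comp_def, Complex.star_def, inner_toLp, ← integral_conj, map_mul,
      Complex.conj_conj] at h1
    refine (h1.congr fun i => ?_).trans (le_of_eq ?_)
    · exact integral_congr_ae (Eventually.of_forall fun z => mul_comm _ _)
    · congr 1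
      exact integral_congr_ae (Eventually.of_forall fun z => mul_comm _ _)
  · have ea : a = (Lp.memLp a).toLp a := (Lp.toLp_coeFn a (Lp.memLp a)).symm
    rw [← norm_toLp_sq (Lp.memLp a), ← ea]
    obtain ⟨i, -⟩ := U.nonempty_of_mem univ_mem
    have hC0 : 0 ≤ C := (integral_nonneg fun z => by positivity).trans (hC i)
    calc ‖a‖ ^ 2 ≤ √C ^ 2 := pow_le_pow_left₀ (norm_nonneg _) ha 2
      _ = C := Real.sq_sqrt hC0

theorem norm_sub_sq_complex (x a : ℂ) :
    ‖x‖ ^ 2 - ‖x - a‖ ^ 2 = 2 * (conj a * x).re - ‖a‖ ^ 2 := by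
  rw [← Complex.normSq_eq_norm_sq, ← Complex.normSq_eq_norm_sq, ← Complex.normSq_eq_norm_sq]
  simp [Complex.normSq_apply]
  ring

/-- The difference ‖x‖² − ‖x − a‖² equals 2 Re⟨a, x⟩ − ‖a‖², which is affine in x and hence weakly
continuous. This is the quadratic counterpart of the Brezis–Lieb splitting. -/
theorem WeakTendsto.tendsto_norm_sq_sub {x : ι → α → ℂ} {l : Filter ι} {a : α → ℂ}
    (h : WeakTendsto μ x l a) (hx : ∀ i, MemLp (x i) 2 μ) (ha : MemLp a 2 μ) :
    Tendsto (fun i => ∫ z, ‖x i z‖ ^ 2 ∂μ - ∫ z, ‖x i z - a z‖ ^ 2 ∂μ) l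
      (𝓝 (∫ z, ‖a z‖ ^ 2 ∂μ)) := by
  have hint : ∀ w, MemLp w 2 μ → Integrable (fun z => conj (a z) * w z) μ := fun w hw =>
    (memLp_conj ha).integrable_mul hw
  have e : ∀ w, MemLp w 2 μ → ∫ z, ‖w z‖ ^ 2 ∂μ - ∫ z, ‖w z - a z‖ ^ 2 ∂μ =
      2 * (∫ z, conj (a z) * w z ∂μ).re - ∫ z, ‖a z‖ ^ 2 ∂μ := by
    intro w hw
    have h1 : Integrable (fun z => ‖w z - a z‖ ^ 2) μ := (hw.sub ha).integrable_norm_sq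
    have h2 : (∫ z, conj (a z) * w z ∂μ).re = ∫ z, (conj (a z) * w z).re ∂μ :=
      (integral_re (hint w hw)).symm
    rw [← integral_sub hw.integrable_norm_sq h1, h2, ← integral_const_mul]
    refine Eq.trans ?_ (integral_sub
      (((hint w hw).re.const_mul 2 :)) ha.integrable_norm_sq)
    exact integral_congr_ae (Eventually.of_forall fun z => norm_sub_sq_complex _ _)
  have key := (((Complex.continuous_re.tendsto _).comp (h _ (memLp_conj ha))).const_mul 2).sub_const
    (∫ z, ‖a z‖ ^ 2 ∂μ)
  -- Taking w = a in the affine identity identifies the limit as ‖a‖².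
  have e0 := e a ha
  simp only [sub_self, norm_zero, ne_eq, OfNat.ofNat_ne_zero, not_false_eq_true, zero_pow,
    integral_zero, sub_zero] at e0
  rw [← e0] at key
  exact key.congr fun i => (e _ (hx i)).symm

end Weak

/-! ### Weak derivatives: linearity, translation, weak closedness -/

section Algebra

variable {L : ℝ} {v : ℝ × ℝ} {u g w k : ℝ × ℝ → ℂ}

theorem IsTestFunction.memLp {φ : ℝ × ℝ → ℝ} (hφ : IsTestFunction L φ) (μ : Measure (ℝ × ℝ))
    [IsFiniteMeasureOnCompacts μ] : MemLp (fun z => (φ z : ℂ)) 2 μ :=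
  (Complex.continuous_ofReal.comp hφ.smooth.continuous).memLp_of_hasCompactSupport
    (hφ.compact.comp_left Complex.ofReal_zero)

theorem IsTestFunction.continuous_fderiv {φ : ℝ × ℝ → ℝ} (hφ : IsTestFunction L φ) (v : ℝ × ℝ) :
    Continuous fun z => fderiv ℝ φ z v :=
  (hφ.smooth.continuous_fderiv (by simp)).clm_apply continuous_const

theorem IsTestFunction.memLp_fderiv {φ : ℝ × ℝ → ℝ} (hφ : IsTestFunction L φ) (v : ℝ × ℝ)
    (μ : Measure (ℝ × ℝ)) [IsFiniteMeasureOnCompacts μ] :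
    MemLp (fun z => ((fderiv ℝ φ z v : ℝ) : ℂ)) 2 μ :=
  (Complex.continuous_ofReal.comp (hφ.continuous_fderiv v)).memLp_of_hasCompactSupport
    ((hφ.compact.fderiv_apply ℝ v).comp_left Complex.ofReal_zero)

theorem IsTestFunction.integrable_smul {φ : ℝ × ℝ → ℝ} (hφ : IsTestFunction L φ)
    {μ : Measure (ℝ × ℝ)} [IsFiniteMeasureOnCompacts μ] (hu : MemLp u 2 μ) :
    Integrable (fun z => φ z • u z) μ := by
  simp only [Complex.real_smul]
  exact (hφ.memLp μ).integrable_mul hu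

theorem IsTestFunction.integrable_fderiv_smul {φ : ℝ × ℝ → ℝ} (hφ : IsTestFunction L φ)
    (v : ℝ × ℝ) {μ : Measure (ℝ × ℝ)} [IsFiniteMeasureOnCompacts μ] (hu : MemLp u 2 μ) :
    Integrable (fun z => fderiv ℝ φ z v • u z) μ := by
  simp only [Complex.real_smul]
  exact (hφ.memLp_fderiv v μ).integrable_mul hu

theorem HasL2WeakDeriv.sub (hu : MemLp u 2 (volume.restrict (strip L)))
    (hw : MemLp w 2 (volume.restrict (strip L))) (hg : HasL2WeakDeriv L v u g)
    (hk : HasL2WeakDeriv L v w k) :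
    HasL2WeakDeriv L v (fun z => u z - w z) (fun z => g z - k z) := by
  refine ⟨hg.memLp.sub hk.memLp, fun φ hφ => ?_⟩
  simp only [smul_sub]
  rw [integral_sub (hφ.integrable_fderiv_smul v hu) (hφ.integrable_fderiv_smul v hw),
    integral_sub (hφ.integrable_smul hg.memLp) (hφ.integrable_smul hk.memLp),
    hg.integral_eq φ hφ, hk.integral_eq φ hφ]
  ring

theorem HasL2WeakDeriv.const_mul (hg : HasL2WeakDeriv L v u g) (c : ℂ) :
    HasL2WeakDeriv L v (fun z => c * u z) (fun z => c * g z) := by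
  refine ⟨hg.memLp.const_mul c, fun φ hφ => ?_⟩
  have := hg.integral_eq φ hφ
  simp only [← mul_smul_comm, integral_const_mul, this, mul_neg]

theorem measurePreserving_shift (L s : ℝ) :
    MeasurePreserving (fun z : ℝ × ℝ => z + (s, 0)) (volume.restrict (strip L))
      (volume.restrict (strip L)) := by
  have h := (measurePreserving_add_right (volume : Measure (ℝ × ℝ)) (s, 0)).restrict_preimage
    (measurableSet_strip L)
  have e : (fun z : ℝ × ℝ => z + (s, 0)) ⁻¹' strip L = strip L := by
    ext z; simp [strip]
  rwa [e] at h

theorem integral_shift (L s : ℝ) {E : Type*} [NormedAddCommGroup E] [NormedSpace ℝ E]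
    (F : ℝ × ℝ → E) : ∫ z in strip L, F (z + (s, 0)) = ∫ z in strip L, F z :=
  (measurePreserving_shift L s).integral_comp
    (Homeomorph.addRight ((s, 0) : ℝ × ℝ)).measurableEmbedding F

theorem IsTestFunction.shift {φ : ℝ × ℝ → ℝ} (hφ : IsTestFunction L φ) (s : ℝ) :
    IsTestFunction L fun z => φ (z + (s, 0)) := by
  refine ⟨hφ.smooth.comp (contDiff_id.add contDiff_const),
    hφ.compact.comp_homeomorph (Homeomorph.addRight ((s, 0) : ℝ × ℝ)), ?_⟩
  have h1 : tsupport (fun z => φ (z + (s, 0))) ⊆ (fun z => z + (s, 0)) ⁻¹' tsupport φ :=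
    tsupport_comp_subset_preimage φ (by fun_prop)
  intro z hz
  have := hφ.supp (h1 hz)
  simpa [openStrip] using this

theorem HasL2WeakDeriv.shift (hg : HasL2WeakDeriv L v u g) (s : ℝ) :
    HasL2WeakDeriv L v (fun z => u (z + (s, 0))) (fun z => g (z + (s, 0))) := by
  refine ⟨hg.memLp.comp_measurePreserving (measurePreserving_shift L s), fun φ hφ => ?_⟩
  have h := hg.integral_eq _ (hφ.shift (-s))
  rw [← integral_shift L s, ← integral_shift L s (fun z => φ (z + (-s, 0)) • g z)] at h
  simp only [fderiv_comp_add_right] at h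
  have e : ∀ z : ℝ × ℝ, z + (s, 0) + (-s, 0) = z := fun z => by ext <;> simp
  simpa only [e] using h

theorem SobolevTriple.sub {h l : ℝ × ℝ → ℂ} (H : SobolevTriple L u g h)
    (K : SobolevTriple L w k l) : SobolevTriple L (fun z => u z - w z) (fun z => g z - k z)
      (fun z => h z - l z) :=
  ⟨H.memLp.sub K.memLp, H.dx.sub H.memLp K.memLp K.dx, H.dy.sub H.memLp K.memLp K.dy⟩

theorem SobolevTriple.const_mul {h : ℝ × ℝ → ℂ} (H : SobolevTriple L u g h) (c : ℂ) :
    SobolevTriple L (fun z => c * u z) (fun z => c * g z) (fun z => c * h z) :=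
  ⟨H.memLp.const_mul c, H.dx.const_mul c, H.dy.const_mul c⟩

theorem SobolevTriple.shift {h : ℝ × ℝ → ℂ} (H : SobolevTriple L u g h) (s : ℝ) :
    SobolevTriple L (fun z => u (z + (s, 0))) (fun z => g (z + (s, 0)))
      (fun z => h (z + (s, 0))) :=
  ⟨H.memLp.comp_measurePreserving (measurePreserving_shift L s), H.dx.shift s, H.dy.shift s⟩

/-- Both sides of the defining identity are pairings with fixed L² functions, so the graph of the
weak derivative is weakly closed. -/
theorem HasL2WeakDeriv.of_weakTendsto {ι : Type*} {l : Filter ι} [l.NeBot]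
    {x y : ι → ℝ × ℝ → ℂ} (h : ∀ i, HasL2WeakDeriv L v (x i) (y i))
    (hx : WeakTendsto (volume.restrict (strip L)) x l u)
    (hy : WeakTendsto (volume.restrict (strip L)) y l g)
    (hg : MemLp g 2 (volume.restrict (strip L))) : HasL2WeakDeriv L v u g := by
  refine ⟨hg, fun φ hφ => ?_⟩
  have h1 := hx _ (hφ.memLp_fderiv v _)
  have h2 := (hy _ (hφ.memLp _)).neg
  simp only [← Complex.real_smul] at h1 h2
  refine tendsto_nhds_unique h1 (h2.congr fun i => ((h i).integral_eq φ hφ).symm)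

end Algebra

/-! ### The modulus of an H¹ function -/

section Modulus

variable {L : ℝ} {v : ℝ × ℝ} {u g : ℝ × ℝ → ℂ}

theorem IsTestFunction.exists_tsupport_subset {φ : ℝ × ℝ → ℝ} (hφ : IsTestFunction L φ) :
    ∃ δ, 0 < δ ∧ tsupport φ ⊆ innerStrip L δ := by
  obtain ⟨δ, h0, h1⟩ := IsCompact.exists_cthickening_subset_open hφ.compact (isOpen_openStrip L)
    hφ.supp
  refine ⟨δ, h0, fun z hz => ⟨mem_univ _, ?_, ?_⟩⟩
  · have := h1 (Metric.mem_cthickening_of_dist_le (z.1, z.2 - δ) z δ _ hz (by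
      simp [Prod.dist_eq, abs_of_pos h0, h0.le]))
    linarith [this.2.1]
  · have := h1 (Metric.mem_cthickening_of_dist_le (z.1, z.2 + δ) z δ _ hz (by
      simp [Prod.dist_eq, abs_of_pos h0, h0.le]))
    linarith [this.2.2]

/-- Dominated convergence: φ is Lipschitz, and as the step is at most 1 every quotient vanishes
outside one fixed ball, on which w is integrable. -/
theorem IsTestFunction.tendsto_integral_difference {φ : ℝ × ℝ → ℝ} (hφ : IsTestFunction L φ)
    (v : ℝ × ℝ) {w : ℝ × ℝ → ℂ} (hw : MemLp w 2 volume) :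
    Tendsto (fun n => ∫ z, (((φ (z - mollRadius n • v) - φ z) / mollRadius n : ℝ) : ℂ) * w z) atTop
      (𝓝 (∫ z, ((-fderiv ℝ φ z v : ℝ) : ℂ) * w z)) := by
  obtain ⟨C, hC⟩ := hφ.smooth.lipschitzWith_of_hasCompactSupport hφ.compact (by simp)
  obtain ⟨R, hR⟩ := hφ.compact.isCompact.isBounded.subset_closedBall 0
  have hr1 : ∀ n, mollRadius n ≤ 1 := fun n => by
    unfold mollRadius
    rw [div_le_one (by positivity)]
    linarith [Nat.cast_nonneg (α := ℝ) n]
  set B := Metric.closedBall (0 : ℝ × ℝ) (R + ‖v‖)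
  have hz0 : ∀ z, z ∉ Metric.closedBall (0 : ℝ × ℝ) R → φ z = 0 := fun z hz =>
    image_eq_zero_of_notMem_tsupport fun h => hz (hR h)
  have hwloc : IntegrableOn w B := (hw.locallyIntegrable (by norm_num)).integrableOn_isCompact
    (isCompact_closedBall _ _)
  refine tendsto_integral_of_dominated_convergence
    (B.indicator fun z => (C * ‖v‖) * ‖w z‖) (fun n => ?_) ?_ (fun n => ?_) ?_
  · have := hφ.smooth.continuous
    exact (Continuous.aestronglyMeasurable (by fun_prop)).mul hw.1
  · exact (integrable_indicator_iff measurableSet_closedBall).2 (hwloc.norm.const_mul _)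
  · refine Eventually.of_forall fun z => ?_
    have hr := mollRadius_pos n
    rw [norm_mul, Complex.norm_real, norm_div, Real.norm_of_nonneg hr.le]
    by_cases hz : z ∈ B
    · rw [indicator_of_mem hz]
      refine mul_le_mul_of_nonneg_right ?_ (norm_nonneg _)
      rw [div_le_iff₀ hr]
      have := hC.norm_sub_le (z - mollRadius n • v) z
      simp only [sub_sub_cancel_left, norm_neg, norm_smul, Real.norm_of_nonneg hr.le] at this
      linarith
    · rw [indicator_of_notMem hz]
      simp only [B, mem_closedBall_zero_iff, not_le] at hz
      have h1 : φ z = 0 := hz0 z (by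
        simp only [mem_closedBall_zero_iff, not_le]; linarith [norm_nonneg v])
      have h2 : φ (z - mollRadius n • v) = 0 := hz0 _ (by
        simp only [mem_closedBall_zero_iff, not_le]
        have e1 := norm_sub_norm_le z (mollRadius n • v)
        rw [norm_smul, Real.norm_of_nonneg hr.le] at e1
        have e2 := mul_le_mul_of_nonneg_right (hr1 n) (norm_nonneg v)
        linarith)
      simp [h1, h2]
  · refine Eventually.of_forall fun z => ?_
    refine Tendsto.mul_const _ ((Complex.continuous_ofReal.tendsto _).comp ?_)
    have hd : HasFDerivAt φ (fderiv ℝ φ z) z :=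
      (hφ.smooth.differentiable (by simp) z).hasFDerivAt
    have hl := (hd.hasLineDerivAt (-v)).tendsto_slope_zero_right
    have ht : Tendsto mollRadius atTop (𝓝[>] 0) :=
      tendsto_nhdsWithin_iff.2 ⟨tendsto_mollRadius, Eventually.of_forall mollRadius_pos⟩
    have := hl.comp ht
    simp only [map_neg] at this
    refine this.congr fun n => ?_
    simp [smul_eq_mul, div_eq_inv_mul, sub_eq_add_neg]

/-- Since ||u(z + tv)| − |u(z)|| ≤ |u(z + tv) − u(z)|, the difference quotients of |u| are bounded
in L² by the norm of g, and any weak limit of them is the weak derivative of |u| with the same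
bound. This avoids a chain rule for the modulus, at the price of an integrated rather than pointwise
bound, which suffices for the minimization. -/
theorem HasL2WeakDeriv.exists_norm (hu : MemLp u 2 (volume.restrict (strip L)))
    (hg : HasL2WeakDeriv L v u g) :
    ∃ G, HasL2WeakDeriv L v (fun z => ((‖u z‖ : ℝ) : ℂ)) G ∧
      ∫ z in strip L, ‖G z‖ ^ 2 ≤ ∫ z in strip L, ‖g z‖ ^ 2 := by
  set w : ℝ × ℝ → ℂ := fun z => ((‖(strip L).indicator u z‖ : ℝ) : ℂ) with hw
  have hwL : MemLp w 2 volume := (memLp_indicator_strip hu).norm.ofReal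
  set t := mollRadius with ht
  -- The margin dominates the displacement t‖v‖; the added 1 keeps it positive even when v = 0.
  set r : ℕ → ℝ := fun n => t n * (‖v‖ + 1) with hr
  have ht0 : ∀ n, 0 < t n := mollRadius_pos
  have hr0 : ∀ n, 0 < r n := fun n => mul_pos (ht0 n) (by positivity)
  have htr : ∀ n, t n * ‖v‖ ≤ r n := fun n =>
    mul_le_mul_of_nonneg_left (by linarith) (ht0 n).le
  set K : ℕ → Set (ℝ × ℝ) := fun n => innerStrip L (3 * r n) with hK
  have hKm : ∀ n, MeasurableSet (K n) := fun n => measurableSet_innerStrip _ _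
  have hKs : ∀ n, K n ⊆ strip L := fun n z hz => ⟨mem_univ _, by
    have := hz.2.1; have := hr0 n; linarith, by have := hz.2.2; have := hr0 n; linarith⟩
  have hKs' : ∀ n, ∀ z ∈ K n, z + t n • v ∈ strip L := by
    intro n z hz
    have h1 : |t n * v.2| ≤ r n := by
      rw [abs_mul, abs_of_pos (ht0 n)]
      exact (mul_le_mul_of_nonneg_left (norm_snd_le v) (ht0 n).le).trans (htr n)
    rw [abs_le] at h1
    have := hr0 n
    obtain ⟨-, h2, h3⟩ := hz
    refine ⟨mem_univ _, ?_, ?_⟩ <;> simp <;> linarith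
  have hshift : ∀ n, MemLp (fun z => w (z + t n • v)) 2 volume := fun n =>
    hwL.comp_measurePreserving (measurePreserving_add_right volume _)
  -- The quotient is cut off near the edges, where it is not controlled. A test function is
  -- supported in K n for large n, so the cutoff does not affect the limit.
  set D : ℕ → ℝ × ℝ → ℂ := fun n =>
    (K n).indicator fun z => (t n : ℂ)⁻¹ * (w (z + t n • v) - w z) with hD
  have hDL : ∀ n, MemLp (D n) 2 volume := fun n =>
    (((hshift n).sub hwL).const_mul _).indicator (hKm n)
  have hDb : ∀ n, ∫ z in strip L, ‖D n z‖ ^ 2 ≤ ∫ z in strip L, ‖g z‖ ^ 2 := by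
    intro n
    have e1 : ∀ (f : ℝ × ℝ → ℂ), MemLp f 2 (volume.restrict (strip L)) →
        ∫ z in strip L, ‖f z‖ ^ 2 = (∫⁻ z in strip L, ‖f z‖ₑ ^ 2).toReal := by
      intro f hf
      rw [integral_eq_lintegral_of_nonneg_ae (Eventually.of_forall fun z => by positivity)
        hf.integrable_norm_sq.1]
      congr 1
      refine lintegral_congr fun z => ?_
      rw [ENNReal.ofReal_pow (norm_nonneg _), ofReal_norm]
    rw [e1 _ ((hDL n).restrict _), e1 _ hg.memLp]
    refine ENNReal.toReal_mono ?_ ?_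
    · have := hg.memLp.eLpNorm_lt_top
      rw [eLpNorm_lt_top_iff_lintegral_rpow_enorm_lt_top (by norm_num) (by norm_num)] at this
      simpa using this.ne
    · calc ∫⁻ z in strip L, ‖D n z‖ₑ ^ 2
          = ∫⁻ z in K n, ‖(t n : ℂ)⁻¹ * (w (z + t n • v) - w z)‖ₑ ^ 2 := by
            have : ∀ z, ‖D n z‖ₑ ^ 2 = (K n).indicator
                (fun z => ‖(t n : ℂ)⁻¹ * (w (z + t n • v) - w z)‖ₑ ^ 2) z := fun z => by
              by_cases hz : z ∈ K n <;> simp [hD, hz]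
            simp only [this]
            rw [lintegral_indicator (hKm n), Measure.restrict_restrict (hKm n),
              inter_eq_left.2 (hKs n)]
        _ ≤ ∫⁻ z in K n, ENNReal.ofReal ((t n)⁻¹) ^ 2 * ‖u (z + t n • v) - u z‖ₑ ^ 2 := by
            refine setLIntegral_mono' (hKm n) fun z hz => ?_
            rw [← mul_pow]
            refine pow_le_pow_left' ?_ 2
            rw [enorm_mul]
            refine mul_le_mul' (le_of_eq ?_) ?_
            · rw [← Complex.ofReal_inv, ← ofReal_norm, Complex.norm_real,
                Real.norm_of_nonneg (inv_nonneg.2 (ht0 n).le)]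
            · simp only [hw, indicator_of_mem (hKs n hz), indicator_of_mem (hKs' n z hz)]
              rw [← Complex.ofReal_sub, enorm_le_iff_norm_le, Complex.norm_real]
              exact abs_norm_sub_norm_le _ _
        _ ≤ ENNReal.ofReal ((t n)⁻¹) ^ 2 *
            (ENNReal.ofReal (t n) ^ 2 * ∫⁻ z in strip L, ‖g z‖ₑ ^ 2) := by
            rw [lintegral_const_mul' _ _ (by finiteness)]
            exact mul_le_mul_right (hg.difference_le hu (hr0 n) (ht0 n).le (htr n)) _
        _ = _ := by
            rw [← mul_assoc, ← mul_pow, ← ENNReal.ofReal_mul (inv_nonneg.2 (ht0 n).le),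
              inv_mul_cancel₀ (ht0 n).ne']
            simp
  obtain ⟨G, hG, hlim, hGle⟩ := exists_weakTendsto (hyperfilter ℕ)
    (fun n => (hDL n).restrict (strip L)) hDb
  refine ⟨G, ⟨hG, fun φ hφ => ?_⟩, hGle⟩
  have l1 := hlim _ (hφ.memLp _)
  have l2 := (hφ.tendsto_integral_difference v hwL).mono_left Nat.hyperfilter_le_atTop
  obtain ⟨δ, hδ, hsub⟩ := hφ.exists_tsupport_subset
  have hr' : Tendsto (fun n => 3 * r n) atTop (𝓝 0) := by
    simpa using (tendsto_mollRadius.mul_const (‖v‖ + 1)).const_mul 3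
  have hev : ∀ᶠ n in atTop, ∫ z in strip L, (φ z : ℂ) * D n z =
      ∫ z, (((φ (z - mollRadius n • v) - φ z) / mollRadius n : ℝ) : ℂ) * w z := by
    filter_upwards [hr'.eventually_lt_const hδ] with n hn
    have hφK : ∀ z, z ∉ K n → φ z = 0 := fun z hz => image_eq_zero_of_notMem_tsupport fun h => by
      obtain ⟨-, h1, h2⟩ := hsub h
      exact hz ⟨mem_univ _, by linarith, by linarith⟩
    have i1 : Integrable fun z => (φ z : ℂ) * w (z + t n • v) :=
      (hφ.memLp _).integrable_mul (hshift n)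
    have i2 : Integrable fun z => (φ z : ℂ) * w z := (hφ.memLp _).integrable_mul hwL
    have hφs : MemLp (fun z => (φ (z - t n • v) : ℂ)) 2 volume :=
      (hφ.memLp volume).comp_measurePreserving (measurePreserving_sub_right volume (t n • v))
    have i3 : Integrable fun z => (φ (z - t n • v) : ℂ) * w z := hφs.integrable_mul hwL
    -- Discrete integration by parts: a translation moves the difference quotient from |u| to φ.
    calc ∫ z in strip L, (φ z : ℂ) * D n z
        = ∫ z, (t n : ℂ)⁻¹ * ((φ z : ℂ) * w (z + t n • v) - (φ z : ℂ) * w z) := by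
          rw [← integral_indicator (measurableSet_strip L)]
          refine integral_congr_ae (Eventually.of_forall fun z => ?_)
          by_cases hz : z ∈ K n
          · simp only [hD, indicator_of_mem (hKs n hz), indicator_of_mem hz]; ring
          · simp [hφK z hz, indicator]
      _ = (t n : ℂ)⁻¹ * ((∫ z, (φ (z - t n • v) : ℂ) * w z) - ∫ z, (φ z : ℂ) * w z) := by
          rw [integral_const_mul, integral_sub i1 i2,
            ← integral_add_right_eq_self (fun z => (φ (z - t n • v) : ℂ) * w z) (t n • v)]
          simp only [add_sub_cancel_right]
      _ = _ := by
          rw [← integral_sub i3 i2, ← integral_const_mul]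
          refine integral_congr_ae (Eventually.of_forall fun z => ?_)
          simp only [← ht]
          push_cast
          ring
  have l3 := tendsto_nhds_unique (l1.congr' (hev.filter_mono Nat.hyperfilter_le_atTop)) l2
  have e : ∫ z, ((-fderiv ℝ φ z v : ℝ) : ℂ) * w z =
      - ∫ z in strip L, fderiv ℝ φ z v • ((‖u z‖ : ℝ) : ℂ) := by
    rw [← integral_indicator (measurableSet_strip L), ← integral_neg]
    refine integral_congr_ae (Eventually.of_forall fun z => ?_)
    by_cases hz : z ∈ strip L <;> simp [hw, hz]
  rw [e] at l3
  simp only [Complex.real_smul] at l3 ⊢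
  rw [l3, neg_neg]

end Modulus

/-! ### Rellich compactness on rectangles -/

theorem setLIntegral_rect_split_fst {a m b : ℝ} (h1 : a ≤ m) (h2 : m ≤ b) (c d : ℝ)
    (F : ℝ × ℝ → ℝ≥0∞) : ∫⁻ z in rect a b c d, F z =
      (∫⁻ z in rect a m c d, F z) + ∫⁻ z in rect m b c d, F z := by
  have e : (rect m b c d : Set (ℝ × ℝ)) =ᵐ[volume] Ioc m b ×ˢ Icc c d :=
    Measure.set_prod_ae_eq Ioc_ae_eq_Icc.symm (ae_eq_refl _)
  rw [setLIntegral_congr e, ← lintegral_union (measurableSet_Ioc.prod measurableSet_Icc), rect,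
    ← Icc_union_Ioc_eq_Icc h1 h2, union_prod]
  · rfl
  · refine Disjoint.set_prod_left ?_ _ _
    exact Set.disjoint_left.2 fun x hx hx' => hx'.1.not_ge hx.2

theorem setLIntegral_rect_split_snd {c m d : ℝ} (h1 : c ≤ m) (h2 : m ≤ d) (a b : ℝ)
    (F : ℝ × ℝ → ℝ≥0∞) : ∫⁻ z in rect a b c d, F z =
      (∫⁻ z in rect a b c m, F z) + ∫⁻ z in rect a b m d, F z := by
  have e : (rect a b m d : Set (ℝ × ℝ)) =ᵐ[volume] Icc a b ×ˢ Ioc m d :=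
    Measure.set_prod_ae_eq (ae_eq_refl _) Ioc_ae_eq_Icc.symm
  rw [setLIntegral_congr e, ← lintegral_union (measurableSet_Icc.prod measurableSet_Ioc), rect,
    ← Icc_union_Ioc_eq_Icc h1 h2, prod_union]
  · rfl
  · refine Disjoint.set_prod_right ?_ _ _
    exact Set.disjoint_left.2 fun x hx hx' => hx'.1.not_ge hx.2

theorem setLIntegral_rect_quarter {a b c d : ℝ} (hab : a ≤ b) (hcd : c ≤ d)
    (F : ℝ × ℝ → ℝ≥0∞) : ∫⁻ z in rect a b c d, F z =
      (∫⁻ z in rect a ((a + b) / 2) c ((c + d) / 2), F z) +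
      (∫⁻ z in rect a ((a + b) / 2) ((c + d) / 2) d, F z) +
      ((∫⁻ z in rect ((a + b) / 2) b c ((c + d) / 2), F z) +
      (∫⁻ z in rect ((a + b) / 2) b ((c + d) / 2) d, F z)) := by
  rw [setLIntegral_rect_split_fst (m := (a + b) / 2) (by linarith) (by linarith),
    setLIntegral_rect_split_snd (m := (c + d) / 2) (a := a) (by linarith) (by linarith),
    setLIntegral_rect_split_snd (m := (c + d) / 2) (b := b) (by linarith) (by linarith)]

/-- Integrating u(z) = (u(z) − u(w)) + u(w) over w expresses μ(univ) u(z) as an oscillation plus the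
integral of u. Together with the double-integral Poincaré inequality it gives control by the
gradient and the mean. -/
theorem mul_lintegral_sq_le {α : Type*} [MeasurableSpace α] {μ : Measure α} [IsFiniteMeasure μ]
    {u : α → ℂ} (hu : Integrable u μ) :
    μ univ * ∫⁻ z, ‖u z‖ₑ ^ 2 ∂μ ≤
      2 * (∫⁻ q, ‖u q.1 - u q.2‖ₑ ^ 2 ∂(μ.prod μ)) + 2 * ‖∫ z, u z ∂μ‖ₑ ^ 2 := by
  by_cases h0 : μ univ = 0
  · simp [h0]
  have hm : AEMeasurable (fun q : α × α => ‖u q.1 - u q.2‖ₑ ^ 2) (μ.prod μ) :=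
    ((hu.1.comp_fst.sub hu.1.comp_snd).enorm).pow_const 2
  have hpt : ∀ z, μ univ ^ 2 * ‖u z‖ₑ ^ 2 ≤
      2 * (μ univ * (∫⁻ w, ‖u z - u w‖ₑ ^ 2 ∂μ) + ‖∫ w, u w ∂μ‖ₑ ^ 2) := by
    intro z
    have h1 : μ univ * ‖u z‖ₑ ≤ (∫⁻ w, ‖u z - u w‖ₑ ∂μ) + ‖∫ w, u w ∂μ‖ₑ := by
      have e : ((μ univ).toReal : ℂ) * u z = (∫ w, (u z - u w) ∂μ) + ∫ w, u w ∂μ := by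
        rw [integral_sub (integrable_const _) hu, integral_const, sub_add_cancel,
          Complex.real_smul]; rfl
      calc μ univ * ‖u z‖ₑ = ‖((μ univ).toReal : ℂ) * u z‖ₑ := by
            rw [enorm_mul]
            congr 1
            rw [← ofReal_norm, Complex.norm_real, Real.norm_of_nonneg ENNReal.toReal_nonneg,
              ENNReal.ofReal_toReal (measure_ne_top _ _)]
        _ ≤ _ := by
            rw [e]
            exact (enorm_add_le _ _).trans
              (add_le_add_left (enorm_integral_le_lintegral_enorm _) _)
    rw [← mul_pow]
    refine (pow_le_pow_left' h1 2).trans ((sq_add_le _ _).trans ?_)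
    refine mul_le_mul_right (add_le_add_left (sq_lintegral_le ?_) _) _
    exact (aestronglyMeasurable_const.sub hu.1).enorm
  have key : μ univ ^ 2 * ∫⁻ z, ‖u z‖ₑ ^ 2 ∂μ ≤ 2 * (μ univ *
      (∫⁻ q, ‖u q.1 - u q.2‖ₑ ^ 2 ∂(μ.prod μ)) + ‖∫ w, u w ∂μ‖ₑ ^ 2 * μ univ) := by
    rw [← lintegral_const_mul' _ _ (by finiteness)]
    refine (lintegral_mono hpt).trans (le_of_eq ?_)
    rw [lintegral_const_mul' _ _ (by finiteness), lintegral_add_right' _ aemeasurable_const,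
      lintegral_const_mul' _ _ (by finiteness), lintegral_prod _ hm, lintegral_const]
  have hfin : μ univ ≠ ⊤ := measure_ne_top _ _
  refine (ENNReal.mul_le_mul_iff_right h0 hfin).1 ?_
  calc μ univ * (μ univ * ∫⁻ z, ‖u z‖ₑ ^ 2 ∂μ) = μ univ ^ 2 * ∫⁻ z, ‖u z‖ₑ ^ 2 ∂μ := by ring
    _ ≤ _ := key
    _ = _ := by ring

theorem volume_rect_ne_top (a b c d : ℝ) : (volume : Measure (ℝ × ℝ)) (rect a b c d) ≠ ⊤ := by
  rw [volume_rect]; finiteness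

theorem isFiniteMeasure_rect (a b c d : ℝ) :
    IsFiniteMeasure ((volume : Measure (ℝ × ℝ)).restrict (rect a b c d)) :=
  ⟨by simpa using (volume_rect_ne_top a b c d).lt_top⟩

theorem integrableOn_rect {L a b c d : ℝ} {u : ℝ × ℝ → ℂ}
    (hu : MemLp u 2 (volume.restrict (strip L))) (hc : 0 ≤ c) (hd : d ≤ L) :
    IntegrableOn u (rect a b c d) := by
  have := isFiniteMeasure_rect a b c d
  exact (hu.mono_measure (Measure.restrict_mono (rect_subset_strip hc hd) le_rfl)).integrable
    (by norm_num)

theorem SobolevTriple.lintegral_sq_le {L a b c d : ℝ} {u g h : ℝ × ℝ → ℂ}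
    (H : SobolevTriple L u g h) (hab : a < b) (hcd : c < d) (hc : 0 ≤ c) (hd : d ≤ L) :
    ∫⁻ z in rect a b c d, ‖u z‖ₑ ^ 2 ≤
      4 * (ENNReal.ofReal (b - a) ^ 2 * (∫⁻ z in rect a b c d, ‖g z‖ₑ ^ 2) +
         ENNReal.ofReal (d - c) ^ 2 * ∫⁻ z in rect a b c d, ‖h z‖ₑ ^ 2) +
      2 * (volume (rect a b c d))⁻¹ * ‖∫ z in rect a b c d, u z‖ₑ ^ 2 := by
  have := isFiniteMeasure_rect a b c d
  have h1 := mul_lintegral_sq_le (integrableOn_rect (a := a) (b := b) H.memLp hc hd)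
  have h2 := H.poincare (a := a) (b := b) hc hd
  rw [← volume_rect] at h2
  rw [Measure.restrict_apply_univ] at h1
  set V := (volume : Measure (ℝ × ℝ)) (rect a b c d)
  have hV0 : V ≠ 0 := by
    simp [V, volume_rect, hab, hcd]
  have hV : V ≠ ⊤ := volume_rect_ne_top a b c d
  refine (ENNReal.mul_le_mul_iff_right hV0 hV).1 (h1.trans ?_)
  refine (add_le_add_left (mul_le_mul_right h2 2) _).trans (le_of_eq ?_)
  have e : ∀ S Y : ℝ≥0∞, V * (4 * S + 2 * V⁻¹ * Y) = 2 * (2 * V * S) + V * V⁻¹ * (2 * Y) :=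
    fun S Y => by ring
  rw [e, ENNReal.mul_inv_cancel hV0 hV, one_mul]

/-- Quarter the rectangle k times and apply Poincaré on each piece: halving the sides gains a factor
1/4 per generation. The errors are multiples of squared integrals over finitely many pieces, which
tend to 0 by weak convergence tested on indicators. -/
theorem rellich_step {L : ℝ} {ι : Type*} {l : Filter ι} {v g h : ι → ℝ × ℝ → ℂ}
    (H : ∀ i, SobolevTriple L (v i) (g i) (h i))
    (hv : WeakTendsto (volume.restrict (strip L)) v l 0) (k : ℕ) {a b c d : ℝ} (hab : a < b)
    (hcd : c < d) (hc : 0 ≤ c) (hd : d ≤ L) :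
    ∃ e : ι → ℝ≥0∞, Tendsto e l (𝓝 0) ∧ ∀ i, ∫⁻ z in rect a b c d, ‖v i z‖ₑ ^ 2 ≤
      4 * 4⁻¹ ^ k * (ENNReal.ofReal (b - a) ^ 2 * (∫⁻ z in rect a b c d, ‖g i z‖ₑ ^ 2) +
         ENNReal.ofReal (d - c) ^ 2 * ∫⁻ z in rect a b c d, ‖h i z‖ₑ ^ 2) + e i := by
  induction k generalizing a b c d with
  | zero =>
    refine ⟨fun i => 2 * (volume (rect a b c d))⁻¹ * ‖∫ z in rect a b c d, v i z‖ₑ ^ 2, ?_,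
      fun i => by simpa using (H i).lintegral_sq_le hab hcd hc hd⟩
    have hV0 : volume (rect a b c d) ≠ 0 := by simp [volume_rect, hab, hcd]
    have hm : MemLp ((rect a b c d).indicator fun _ => (1 : ℂ)) 2 (volume.restrict (strip L)) :=
      ((memLp_indicator_const 2 (measurableSet_rect a b c d) 1
        (Or.inr (volume_rect_ne_top a b c d))).restrict _)
    have h1 := hv _ hm
    have e : ∀ i, ∫ z in strip L, (rect a b c d).indicator (fun _ => (1 : ℂ)) z * v i z =
        ∫ z in rect a b c d, v i z := by
      intro i
      have : ∀ z, (rect a b c d).indicator (fun _ => (1 : ℂ)) z * v i z =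
          (rect a b c d).indicator (v i) z := fun z => by
        by_cases hz : z ∈ rect a b c d <;> simp [hz]
      simp only [this]
      rw [integral_indicator (measurableSet_rect _ _ _ _), Measure.restrict_restrict
        (measurableSet_rect _ _ _ _), inter_eq_left.2 (rect_subset_strip hc hd)]
    simp only [e, Pi.zero_apply, mul_zero, integral_zero] at h1
    have h2 : Tendsto (fun i => ‖∫ z in rect a b c d, v i z‖ₑ ^ 2) l (𝓝 0) := by
      have := ((ENNReal.continuous_pow 2).comp continuous_enorm).tendsto (0 : ℂ) |>.comp h1
      simpa [Function.comp_def] using this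
    have h3 := ENNReal.Tendsto.const_mul (a := 2 * (volume (rect a b c d))⁻¹) h2
      (Or.inr (ENNReal.mul_ne_top (by norm_num) (ENNReal.inv_ne_top.2 hV0)))
    simpa using h3
  | succ k ih =>
    have m1 : a < (a + b) / 2 := by linarith
    have m2 : (a + b) / 2 < b := by linarith
    have m3 : c < (c + d) / 2 := by linarith
    have m4 : (c + d) / 2 < d := by linarith
    obtain ⟨e1, t1, l1⟩ := ih m1 m3 hc (by linarith)
    obtain ⟨e2, t2, l2⟩ := ih m1 m4 (by linarith) hd
    obtain ⟨e3, t3, l3⟩ := ih m2 m3 hc (by linarith)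
    obtain ⟨e4, t4, l4⟩ := ih m2 m4 (by linarith) hd
    refine ⟨fun i => e1 i + e2 i + (e3 i + e4 i), by simpa using (t1.add t2).add (t3.add t4),
      fun i => ?_⟩
    have half : ∀ x : ℝ, ENNReal.ofReal (x / 2) ^ 2 = 4⁻¹ * ENNReal.ofReal x ^ 2 := fun x => by
      rw [div_eq_inv_mul, ENNReal.ofReal_mul (by norm_num), mul_pow,
        ENNReal.ofReal_inv_of_pos (by norm_num), ← ENNReal.inv_pow]
      norm_num
    have w1 : (a + b) / 2 - a = (b - a) / 2 := by ring
    have w2 : b - (a + b) / 2 = (b - a) / 2 := by ring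
    have w3 : (c + d) / 2 - c = (d - c) / 2 := by ring
    have w4 : d - (c + d) / 2 = (d - c) / 2 := by ring
    specialize l1 i
    specialize l2 i
    specialize l3 i
    specialize l4 i
    rw [w1, w3, half, half] at l1
    rw [w1, w4, half, half] at l2
    rw [w2, w3, half, half] at l3
    rw [w2, w4, half, half] at l4
    rw [setLIntegral_rect_quarter hab.le hcd.le (fun z => ‖v i z‖ₑ ^ 2),
      setLIntegral_rect_quarter hab.le hcd.le (fun z => ‖g i z‖ₑ ^ 2),
      setLIntegral_rect_quarter hab.le hcd.le (fun z => ‖h i z‖ₑ ^ 2)]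
    refine (add_le_add (add_le_add l1 l2) (add_le_add l3 l4)).trans (le_of_eq ?_)
    rw [pow_succ]
    ring

theorem le_tripleEnergy_left (u g h : ℝ × ℝ → ℂ) (S : Set (ℝ × ℝ)) :
    ∫⁻ z in S, ‖u z‖ₑ ^ 2 ≤ tripleEnergy u g h S :=
  lintegral_mono fun z => by rw [add_assoc]; exact le_self_add

theorem le_tripleEnergy_middle (u g h : ℝ × ℝ → ℂ) (S : Set (ℝ × ℝ)) :
    ∫⁻ z in S, ‖g z‖ₑ ^ 2 ≤ tripleEnergy u g h S :=
  lintegral_mono fun z => by rw [add_right_comm]; exact le_add_self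

theorem le_tripleEnergy_right (u g h : ℝ × ℝ → ℂ) (S : Set (ℝ × ℝ)) :
    ∫⁻ z in S, ‖h z‖ₑ ^ 2 ≤ tripleEnergy u g h S :=
  lintegral_mono fun _ => le_add_self

theorem tripleEnergy_mono (u g h : ℝ × ℝ → ℂ) {S T : Set (ℝ × ℝ)} (hST : S ⊆ T) :
    tripleEnergy u g h S ≤ tripleEnergy u g h T := lintegral_mono_set hST

/-- Weakly null bounded sequences in `H¹` of the strip are strongly null in `L²` of rectangles. -/
theorem tendsto_lintegral_sq_rect {L : ℝ} {ι : Type*} {l : Filter ι} {v g h : ι → ℝ × ℝ → ℂ}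
    (H : ∀ i, SobolevTriple L (v i) (g i) (h i))
    (hv : WeakTendsto (volume.restrict (strip L)) v l 0) {M : ℝ≥0∞} (hM : M ≠ ⊤)
    (hb : ∀ i, tripleEnergy (v i) (g i) (h i) (strip L) ≤ M) {a b c d : ℝ} (hab : a < b)
    (hcd : c < d) (hc : 0 ≤ c) (hd : d ≤ L) :
    Tendsto (fun i => ∫⁻ z in rect a b c d, ‖v i z‖ₑ ^ 2) l (𝓝 0) := by
  have hs := rect_subset_strip (a := a) (b := b) hc hd
  set D : ℝ≥0∞ := ENNReal.ofReal (b - a) ^ 2 * M + ENNReal.ofReal (d - c) ^ 2 * M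
  have hD : D ≠ ⊤ := by finiteness
  have ht : Tendsto (fun k : ℕ => 4 * (4⁻¹ : ℝ≥0∞) ^ k * D) atTop (𝓝 0) := by
    have h1 : Tendsto (fun k : ℕ => (4⁻¹ : ℝ≥0∞) ^ k) atTop (𝓝 0) :=
      ENNReal.tendsto_pow_atTop_nhds_zero_of_lt_one (by simp)
    have h2 := ENNReal.Tendsto.mul_const (ENNReal.Tendsto.const_mul (a := 4) h1
      (Or.inr (by norm_num))) (b := D) (Or.inr hD)
    simpa using h2
  rw [ENNReal.tendsto_nhds_zero] at ht ⊢
  intro ε hε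
  have hε2 : 0 < ε / 2 := ENNReal.half_pos hε.ne'
  -- The depth k is chosen first, using the uniform energy bound; only then is the limit in i taken,
  -- with finitely many pieces.
  obtain ⟨k, hk⟩ := (ht (ε / 2) hε2).exists
  obtain ⟨e, he, hle⟩ := rellich_step H hv k hab hcd hc hd
  filter_upwards [ENNReal.tendsto_nhds_zero.1 he (ε / 2) hε2] with i hi
  refine (hle i).trans ?_
  rw [← ENNReal.add_halves ε]
  refine add_le_add (le_trans ?_ hk) hi
  refine mul_le_mul_right (add_le_add (mul_le_mul_right ?_ _) (mul_le_mul_right ?_ _)) _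
  · exact (le_tripleEnergy_middle _ _ _ _).trans ((tripleEnergy_mono _ _ _ hs).trans (hb i))
  · exact (le_tripleEnergy_right _ _ _ _).trans ((tripleEnergy_mono _ _ _ hs).trans (hb i))

/-! ### Sobolev embedding into L^q, local convergence and non-vanishing -/

theorem rpow_le_sq_add_pow (x : ℝ≥0∞) {q : ℝ} {s : ℕ} (h1 : 2 ≤ q) (h2 : q ≤ 2 * (s + 1)) :
    x ^ q ≤ x ^ 2 + x ^ (2 * (s + 1)) := by
  rcases le_total x 1 with hx | hx
  · refine le_trans ?_ le_self_add
    rw [← ENNReal.rpow_two]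
    exact ENNReal.rpow_le_rpow_of_exponent_ge hx h1
  · refine le_trans ?_ le_add_self
    rw [← ENNReal.rpow_natCast]
    refine ENNReal.rpow_le_rpow_of_exponent_le hx ?_
    push_cast
    exact h2

theorem SobolevTriple.aestronglyMeasurable_rect {L a b c d : ℝ} {u g h : ℝ × ℝ → ℂ}
    (H : SobolevTriple L u g h) (hc : 0 ≤ c) (hd : d ≤ L) :
    AEStronglyMeasurable u (volume.restrict (rect a b c d)) :=
  H.memLp.1.mono_measure (Measure.restrict_mono (rect_subset_strip hc hd) le_rfl)

/-- Normalize u by the square root l of its energy, interpolate x^q ≤ x² + x^{2(s+1)}, and undo the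
scaling. The summands contribute 1 and C to the constant. Uniformity in a is what allows summing
over blocks. -/
theorem exists_sobolev_rpow {L A q : ℝ} (hL : 0 < L) (hA : 0 < A) (hq : 2 ≤ q) :
    ∃ C : ℝ≥0∞, C ≠ 0 ∧ C ≠ ⊤ ∧ ∀ u g h, SobolevTriple L u g h → ∀ a,
      ∫⁻ z in rect a (a + A) 0 L, ‖u z‖ₑ ^ q ≤
        C * tripleEnergy u g h (rect a (a + A) 0 L) ^ (q / 2) := by
  obtain ⟨s, hs⟩ := exists_nat_ge q
  have hs' : q ≤ 2 * ((s : ℝ) + 1) := by linarith [Nat.cast_nonneg (α := ℝ) s]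
  set C := sobolevConst (ENNReal.ofReal A) (ENNReal.ofReal L) s with hC
  have hCt : C ≠ ⊤ := sobolevConst_ne_top (by simpa using hA) (by simpa using hL) (by finiteness)
    (by finiteness) s
  refine ⟨1 + C, by simp, by finiteness, fun u g h H a => ?_⟩
  have hm := H.aestronglyMeasurable_rect (a := a) (b := a + A) le_rfl le_rfl
  set R := rect a (a + A) 0 L with hR
  set E := tripleEnergy u g h R with hE
  have hq2 : 0 < q / 2 := by linarith
  by_cases hE0 : E = 0
  · have h0 : ∫⁻ z in R, ‖u z‖ₑ ^ 2 = 0 := le_antisymm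
      ((le_tripleEnergy_left u g h R).trans hE0.le) bot_le
    rw [lintegral_eq_zero_iff' (hm.enorm.pow_const 2)] at h0
    have h1 : ∫⁻ z in R, ‖u z‖ₑ ^ q = 0 := by
      rw [lintegral_eq_zero_iff' (hm.enorm.pow_const q)]
      filter_upwards [h0] with z hz
      have : ‖u z‖ₑ = 0 := by simpa using hz
      simp only [this, Pi.zero_apply]
      exact ENNReal.zero_rpow_of_pos (by linarith)
    rw [h1]
    exact bot_le
  by_cases hEt : E = ⊤
  · rw [hEt, ENNReal.top_rpow_of_pos hq2, ENNReal.mul_top (by simp)]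
    exact le_top
  set l : ℝ≥0∞ := E ^ (1 / 2 : ℝ) with hl
  have l0 : l ≠ 0 := by simp [hl, hE0]
  have lt : l ≠ ⊤ := ENNReal.rpow_ne_top_of_nonneg (by norm_num) hEt
  have l2 : l ^ 2 = E := by
    rw [hl, ← ENNReal.rpow_natCast, ← ENNReal.rpow_mul]; norm_num
  have lq : l ^ q = E ^ (q / 2) := by
    rw [hl, ← ENNReal.rpow_mul]; congr 1; ring
  have li : (l⁻¹) ^ 2 = E⁻¹ := by rw [← ENNReal.inv_pow, l2]
  have hfin : (l⁻¹) ≠ ⊤ := ENNReal.inv_ne_top.2 l0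
  have i1 : ∫⁻ z in R, (l⁻¹ * ‖u z‖ₑ) ^ 2 ≤ 1 := by
    simp only [mul_pow, li]
    rw [lintegral_const_mul' _ _ (ENNReal.inv_ne_top.2 hE0)]
    calc _ ≤ E⁻¹ * E := mul_le_mul_right (le_tripleEnergy_left u g h R) _
      _ = 1 := ENNReal.inv_mul_cancel hE0 hEt
  have i2 : ∫⁻ z in R, (l⁻¹ * ‖u z‖ₑ) ^ (2 * (s + 1)) ≤ C := by
    simp only [mul_pow]
    rw [lintegral_const_mul' _ _ (by finiteness)]
    have := H.sobolev (a := a) (b := a + A) (c := 0) (d := L) (by linarith) hL le_rfl le_rfl s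
    rw [add_sub_cancel_left, sub_zero] at this
    calc _ ≤ (l⁻¹) ^ (2 * (s + 1)) * (C * E ^ (s + 1)) := mul_le_mul_right this _
      _ = C * (E⁻¹ * E) ^ (s + 1) := by rw [pow_mul, li, mul_pow]; ring
      _ = C := by rw [ENNReal.inv_mul_cancel hE0 hEt, one_pow, mul_one]
  calc ∫⁻ z in R, ‖u z‖ₑ ^ q = ∫⁻ z in R, l ^ q * (l⁻¹ * ‖u z‖ₑ) ^ q := by
        refine lintegral_congr fun z => ?_
        rw [← ENNReal.mul_rpow_of_nonneg _ _ (by linarith), ← mul_assoc,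
          ENNReal.mul_inv_cancel l0 lt, one_mul]
    _ = l ^ q * ∫⁻ z in R, (l⁻¹ * ‖u z‖ₑ) ^ q :=
        lintegral_const_mul' _ _ (ENNReal.rpow_ne_top_of_nonneg (by linarith) lt)
    _ ≤ l ^ q * ∫⁻ z in R, ((l⁻¹ * ‖u z‖ₑ) ^ 2 + (l⁻¹ * ‖u z‖ₑ) ^ (2 * (s + 1))) :=
        mul_le_mul_right (lintegral_mono fun z => rpow_le_sq_add_pow _ hq hs') _
    _ ≤ l ^ q * (1 + C) := by
        refine mul_le_mul_right ?_ _
        rw [lintegral_add_left' ((hm.enorm.const_mul _).pow_const 2)]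
        exact add_le_add i1 i2
    _ = _ := by rw [lq, mul_comm]

/-- The `k`-th unit block of the strip. -/
def block (L : ℝ) (k : ℤ) : Set (ℝ × ℝ) := rect k (k + 1) 0 L

theorem block_subset_strip (L : ℝ) (k : ℤ) : block L k ⊆ strip L :=
  rect_subset_strip le_rfl le_rfl

theorem setLIntegral_strip_eq_tsum (L : ℝ) (F : ℝ × ℝ → ℝ≥0∞) :
    ∫⁻ z in strip L, F z = ∑' k : ℤ, ∫⁻ z in block L k, F z := by
  have e : strip L = ⋃ k : ℤ, Ico (k : ℝ) (k + 1) ×ˢ Icc 0 L := by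
    rw [← iUnion_prod_const, iUnion_Ico_intCast]; rfl
  rw [e, lintegral_iUnion (fun k => measurableSet_Ico.prod measurableSet_Icc)]
  · refine tsum_congr fun k => setLIntegral_congr ?_
    exact Measure.set_prod_ae_eq Ico_ae_eq_Icc (ae_eq_refl _)
  · exact fun i j hij => Disjoint.set_prod_left (pairwise_disjoint_Ico_intCast ℝ hij) _ _

/-- With E_k the energy of block k, E_k^{q/2} ≤ E_k E^{q/2−1} because q ≥ 2, and the E_k sum to E.
-/
theorem exists_sobolev_rpow_strip {L q : ℝ} (hL : 0 < L) (hq : 2 ≤ q) :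
    ∃ C : ℝ≥0∞, C ≠ ⊤ ∧ ∀ u g h, SobolevTriple L u g h →
      ∫⁻ z in strip L, ‖u z‖ₑ ^ q ≤ C * tripleEnergy u g h (strip L) ^ (q / 2) := by
  obtain ⟨C, -, hC, hS⟩ := exists_sobolev_rpow hL one_pos hq
  refine ⟨C, hC, fun u g h H => ?_⟩
  set E := tripleEnergy u g h (strip L) with hE
  have split : ∀ x : ℝ≥0∞, x ^ (q / 2) = x * x ^ (q / 2 - 1) := fun x => by
    conv_rhs => rw [← ENNReal.rpow_one x]
    rw [← ENNReal.rpow_mul, one_mul, ← ENNReal.rpow_add_of_nonneg _ _ (by norm_num) (by linarith)]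
    congr 1
    ring
  rw [setLIntegral_strip_eq_tsum]
  calc ∑' k : ℤ, ∫⁻ z in block L k, ‖u z‖ₑ ^ q
      ≤ ∑' k : ℤ, C * E ^ (q / 2 - 1) * tripleEnergy u g h (block L k) := by
        refine ENNReal.tsum_le_tsum fun k => (hS u g h H k).trans ?_
        rw [split, mul_assoc]
        refine mul_le_mul_right ?_ _
        rw [mul_comm]
        refine mul_le_mul' (ENNReal.rpow_le_rpow ?_ (by linarith)) le_rfl
        exact tripleEnergy_mono u g h (block_subset_strip L k)
    _ = C * E ^ (q / 2) := by
        rw [ENNReal.tsum_mul_left, split, mul_assoc, mul_comm E]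
        congr 2
        rw [hE, tripleEnergy, setLIntegral_strip_eq_tsum]
        rfl

/-- The quadratic part of the Nehari functional on the set `S`. -/
def quadEnergy (ω : ℝ) (u g h : ℝ × ℝ → ℂ) (S : Set (ℝ × ℝ)) : ℝ≥0∞ :=
  ∫⁻ z in S, (ENNReal.ofReal ω * ‖u z‖ₑ ^ 2 + ‖g z‖ₑ ^ 2 + ‖h z‖ₑ ^ 2)

theorem tripleEnergy_le_quadEnergy {ω : ℝ} (hω : 0 < ω) (u g h : ℝ × ℝ → ℂ)
    (S : Set (ℝ × ℝ)) :
    tripleEnergy u g h S ≤ (1 + (ENNReal.ofReal ω)⁻¹) * quadEnergy ω u g h S := by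
  have h0 : ENNReal.ofReal ω ≠ 0 := by simpa using hω
  have hi : (ENNReal.ofReal ω)⁻¹ ≠ ⊤ := ENNReal.inv_ne_top.2 h0
  rw [quadEnergy, ← lintegral_const_mul' _ _ (by finiteness)]
  refine lintegral_mono fun z => ?_
  have e : ∀ x y w : ℝ≥0∞, (1 + (ENNReal.ofReal ω)⁻¹) * (ENNReal.ofReal ω * x + y + w) =
      x * ((ENNReal.ofReal ω)⁻¹ * ENNReal.ofReal ω) + y + w +
        (ENNReal.ofReal ω * x + (ENNReal.ofReal ω)⁻¹ * (y + w)) := fun x y w => by ring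
  rw [e, ENNReal.inv_mul_cancel h0 (by finiteness), mul_one]
  exact le_self_add

/-- On a block with 0 ≠ Q_k ≤ P_k, the Sobolev bound P_k ≤ D Q_k^{(p+1)/2} yields 1 ≤ D
Q_k^{(p−1)/2}. This bounds Q_k, hence P_k, below by a constant independent of u. -/
theorem exists_block_lower_bound {L p ω : ℝ} (hL : 0 < L) (hp : 1 < p) (hω : 0 < ω) :
    ∃ δ : ℝ≥0∞, δ ≠ 0 ∧ ∀ u g h, SobolevTriple L u g h →
      ∫⁻ z in strip L, ‖u z‖ₑ ^ (p + 1) = quadEnergy ω u g h (strip L) →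
      quadEnergy ω u g h (strip L) ≠ 0 → quadEnergy ω u g h (strip L) ≠ ⊤ →
      ∃ k : ℤ, δ ≤ ∫⁻ z in block L k, ‖u z‖ₑ ^ (p + 1) := by
  obtain ⟨C, hC0, hC, hS⟩ := exists_sobolev_rpow (q := p + 1) hL one_pos (by linarith)
  have h0 : ENNReal.ofReal ω ≠ 0 := by simpa using hω
  have hi : (ENNReal.ofReal ω)⁻¹ ≠ ⊤ := ENNReal.inv_ne_top.2 h0
  set K : ℝ≥0∞ := 1 + (ENNReal.ofReal ω)⁻¹ with hK
  have hKt : K ≠ ⊤ := by finiteness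
  set D : ℝ≥0∞ := C * K ^ ((p + 1) / 2) with hD
  have hDt : D ≠ ⊤ := ENNReal.mul_ne_top hC (ENNReal.rpow_ne_top_of_nonneg (by linarith) hKt)
  have hr : 0 < (p - 1) / 2 := by linarith
  refine ⟨(D⁻¹) ^ ((p - 1) / 2)⁻¹, ?_, fun u g h H hPQ hQ0 hQt => ?_⟩
  · rw [ne_eq, ENNReal.rpow_eq_zero_iff]
    rintro (⟨h, -⟩ | ⟨-, h⟩)
    · exact ENNReal.inv_ne_zero.2 hDt h
    · exact absurd h (inv_pos.2 hr).not_gt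
  set Q : ℤ → ℝ≥0∞ := fun k => quadEnergy ω u g h (block L k) with hQ
  set P : ℤ → ℝ≥0∞ := fun k => ∫⁻ z in block L k, ‖u z‖ₑ ^ (p + 1) with hP
  have hle : ∀ k, P k ≤ D * Q k ^ ((p + 1) / 2) := fun k => by
    refine (hS u g h H k).trans ?_
    rw [hD, mul_assoc, ← ENNReal.mul_rpow_of_nonneg _ _ (by linarith)]
    exact mul_le_mul_right (ENNReal.rpow_le_rpow (tripleEnergy_le_quadEnergy hω u g h _)
      (by linarith)) _
  have sQ : quadEnergy ω u g h (strip L) = ∑' k, Q k := setLIntegral_strip_eq_tsum L _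
  have sP : ∫⁻ z in strip L, ‖u z‖ₑ ^ (p + 1) = ∑' k, P k := setLIntegral_strip_eq_tsum L _
  -- Otherwise P_k < Q_k wherever Q_k ≠ 0, while P_k = 0 wherever Q_k = 0; summing contradicts the
  -- equality of the finite totals.
  obtain ⟨k, hk0, hk⟩ : ∃ k, Q k ≠ 0 ∧ Q k ≤ P k := by
    by_contra! hcon
    obtain ⟨j, hj⟩ : ∃ j, Q j ≠ 0 := by
      by_contra! hall
      exact hQ0 (by rw [sQ]; simp [hall])
    have hlt : ∑' k, P k < ∑' k, Q k := by
      refine ENNReal.tsum_lt_tsum (i := j) ?_ (fun k => ?_) (hcon j hj)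
      · rw [← sP, hPQ]; exact hQt
      · by_cases hk : Q k = 0
        · have := hle k
          rw [hk, ENNReal.zero_rpow_of_pos (by linarith), mul_zero] at this
          exact this.trans bot_le
        · exact (hcon k hk).le
    rw [← sP, ← sQ, hPQ] at hlt
    exact lt_irrefl _ hlt
  have hkt : Q k ≠ ⊤ := ne_top_of_le_ne_top hQt (lintegral_mono_set (block_subset_strip L k))
  refine ⟨k, le_trans ?_ hk⟩
  rw [ENNReal.rpow_inv_le_iff hr, ENNReal.inv_le_iff_inv_le]
  have h1 := hk.trans (hle k)
  have e : Q k ^ ((p + 1) / 2) = Q k * Q k ^ ((p - 1) / 2) := by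
    conv_rhs => rw [← ENNReal.rpow_one (Q k)]
    rw [← ENNReal.rpow_mul, one_mul, ← ENNReal.rpow_add_of_nonneg _ _ (by norm_num) hr.le]
    congr 1
    ring
  rw [e, mul_left_comm] at h1
  have h2 : 1 ≤ D * Q k ^ ((p - 1) / 2) := by
    refine (ENNReal.mul_le_mul_iff_right hk0 hkt).1 ?_
    rwa [mul_one]
  rw [ENNReal.inv_le_iff_le_mul]
  · rwa [mul_comm]
  · intro h; exact absurd h hDt
  · intro h; exact absurd h (ENNReal.rpow_ne_top_of_nonneg hr.le hkt)

/-- Cauchy–Schwarz on |v|^{p+1} = |v| · |v|^p: the L² norm tends to 0 on the rectangle by Rellich,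
and the L^{2p} norm stays bounded on the strip by Sobolev. -/
theorem tendsto_lintegral_rpow_rect {L p : ℝ} (hL : 0 < L) (hp : 1 < p) {ι : Type*}
    {l : Filter ι} {v g h : ι → ℝ × ℝ → ℂ} (H : ∀ i, SobolevTriple L (v i) (g i) (h i))
    (hv : WeakTendsto (volume.restrict (strip L)) v l 0) {M : ℝ≥0∞} (hM : M ≠ ⊤)
    (hb : ∀ i, tripleEnergy (v i) (g i) (h i) (strip L) ≤ M) {a b : ℝ} (hab : a < b) :
    Tendsto (fun i => ∫⁻ z in rect a b 0 L, ‖v i z‖ₑ ^ (p + 1)) l (𝓝 0) := by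
  obtain ⟨C, hC, hS⟩ := exists_sobolev_rpow_strip (q := 2 * p) hL (by linarith)
  have h1 := tendsto_lintegral_sq_rect H hv hM hb hab hL le_rfl le_rfl
  set D := C * M ^ p with hD
  have hDt : D ≠ ⊤ := ENNReal.mul_ne_top hC (ENNReal.rpow_ne_top_of_nonneg (by linarith) hM)
  have h2 := ENNReal.Tendsto.mul_const h1 (b := D) (Or.inr hDt)
  have h3 := ((ENNReal.continuous_rpow_const (y := (2 : ℝ)⁻¹)).tendsto _).comp h2
  rw [zero_mul, ENNReal.zero_rpow_of_pos (by norm_num)] at h3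
  refine tendsto_of_tendsto_of_tendsto_of_le_of_le tendsto_const_nhds h3 (fun i => bot_le)
    fun i => ?_
  have hm := (H i).aestronglyMeasurable_rect (a := a) (b := b) le_rfl le_rfl
  simp only [Function.comp_apply]
  rw [ENNReal.le_rpow_inv_iff (by norm_num), ENNReal.rpow_two]
  have e1 : ∀ z, ‖v i z‖ₑ ^ (p + 1) = ‖v i z‖ₑ * ‖v i z‖ₑ ^ p := fun z => by
    rw [ENNReal.rpow_add_of_nonneg _ _ (by linarith) (by norm_num), ENNReal.rpow_one, mul_comm]
  have e2 : ∀ z, (‖v i z‖ₑ ^ p) ^ 2 = ‖v i z‖ₑ ^ (2 * p) := fun z => by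
    rw [← ENNReal.rpow_two, ← ENNReal.rpow_mul, mul_comm]
  simp only [e1]
  refine (sq_lintegral_mul_le hm.enorm (hm.enorm.pow_const p)).trans ?_
  simp only [e2]
  refine mul_le_mul_right ?_ _
  refine (lintegral_mono_set (rect_subset_strip le_rfl le_rfl)).trans
    ((hS _ _ _ (H i)).trans ?_)
  rw [hD, mul_div_cancel_left₀ p two_ne_zero]
  exact mul_le_mul_right (ENNReal.rpow_le_rpow (hb i) (by linarith)) _

/-! ### L^q norms and the Brezis–Lieb splitting -/

section

section Power

variable {α : Type*} [MeasurableSpace α] {μ : Measure α} {q : ℝ}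

theorem integral_rpow_eq_toReal {f : α → ℂ} (hf : AEStronglyMeasurable f μ) (hq : 0 ≤ q) :
    ∫ z, ‖f z‖ ^ q ∂μ = (∫⁻ z, ‖f z‖ₑ ^ q ∂μ).toReal := by
  rw [integral_eq_lintegral_of_nonneg_ae (Eventually.of_forall fun z => by positivity)
    (hf.norm.aemeasurable.pow_const q).aestronglyMeasurable]
  congr 1
  refine lintegral_congr fun z => ?_
  rw [← ENNReal.ofReal_rpow_of_nonneg (norm_nonneg _) hq, ofReal_norm]

theorem memLp_of_lintegral_rpow_ne_top {f : α → ℂ} (hf : AEStronglyMeasurable f μ) (hq : 0 < q)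
    (h : ∫⁻ z, ‖f z‖ₑ ^ q ∂μ ≠ ⊤) : MemLp f (ENNReal.ofReal q) μ := by
  refine ⟨hf, ?_⟩
  rw [eLpNorm_lt_top_iff_lintegral_rpow_enorm_lt_top (by simpa using hq) (by simp),
    ENNReal.toReal_ofReal hq.le]
  exact h.lt_top

theorem _root_.MeasureTheory.MemLp.integrable_rpow {f : α → ℂ} (hq : 0 < q)
    (hf : MemLp f (ENNReal.ofReal q) μ) : Integrable (fun z => ‖f z‖ ^ q) μ := by
  have := hf.integrable_norm_rpow (by simpa using hq) (by simp)
  rwa [ENNReal.toReal_ofReal hq.le] at this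

/-- The `L^q` norm as a real number. -/
def powNorm (μ : Measure α) (q : ℝ) (f : α → ℂ) : ℝ := (∫ z, ‖f z‖ ^ q ∂μ) ^ q⁻¹

theorem powNorm_nonneg (f : α → ℂ) : 0 ≤ powNorm μ q f :=
  Real.rpow_nonneg (integral_nonneg fun z => by positivity) _

theorem powNorm_rpow (hq : 0 < q) (f : α → ℂ) : powNorm μ q f ^ q = ∫ z, ‖f z‖ ^ q ∂μ :=
  Real.rpow_inv_rpow (integral_nonneg fun z => by positivity) hq.ne'

theorem powNorm_eq_norm_toLp (hq : 0 < q) {f : α → ℂ} (hf : MemLp f (ENNReal.ofReal q) μ) :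
    powNorm μ q f = ‖hf.toLp f‖ := by
  rw [Lp.norm_toLp, hf.eLpNorm_eq_integral_rpow_norm (by simpa using hq) (by simp),
    ENNReal.toReal_ofReal hq.le, ENNReal.toReal_ofReal]
  · rfl
  · exact Real.rpow_nonneg (integral_nonneg fun z => by positivity) _

theorem abs_powNorm_sub_le (hq : 1 ≤ q) {f g : α → ℂ} (hf : MemLp f (ENNReal.ofReal q) μ)
    (hg : MemLp g (ENNReal.ofReal q) μ) :
    |powNorm μ q f - powNorm μ q g| ≤ powNorm μ q (fun z => f z - g z) := by
  have h0 : 0 < q := by linarith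
  have : Fact (1 ≤ ENNReal.ofReal q) := ⟨by simpa using hq⟩
  rw [powNorm_eq_norm_toLp h0 hf, powNorm_eq_norm_toLp h0 hg,
    show powNorm μ q (fun z => f z - g z) = _ from powNorm_eq_norm_toLp h0 (hf.sub hg)]
  exact abs_norm_sub_norm_le _ _

theorem powNorm_le_of_integral_le (hq : 0 < q) {f : α → ℂ} {K : ℝ}
    (h : ∫ z, ‖f z‖ ^ q ∂μ ≤ K) : powNorm μ q f ≤ K ^ q⁻¹ :=
  Real.rpow_le_rpow (integral_nonneg fun z => by positivity) h (by positivity)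

end Power

variable {L : ℝ}

theorem iUnion_rect (L : ℝ) : ⋃ m : ℕ, rect (-((m : ℝ) + 1)) (m + 1) 0 L = strip L := by
  ext z
  simp only [mem_iUnion]
  constructor
  · rintro ⟨m, hm⟩
    exact rect_subset_strip le_rfl le_rfl hm
  · intro hz
    obtain ⟨m, hm⟩ := exists_nat_ge |z.1|
    rw [abs_le] at hm
    exact ⟨m, ⟨by linarith, by linarith⟩, hz.2⟩

theorem tendsto_integral_tail {F : ℝ × ℝ → ℝ} (hF : IntegrableOn F (strip L)) :
    Tendsto (fun m : ℕ => ∫ z in strip L \ rect (-((m : ℝ) + 1)) (m + 1) 0 L, F z) atTop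
      (𝓝 0) := by
  have h1 := tendsto_setIntegral_of_monotone (μ := volume) (f := F)
    (s := fun m : ℕ => rect (-((m : ℝ) + 1)) (m + 1) 0 L) (fun m => measurableSet_rect _ _ _ _)
    (fun i j hij z hz => by
      have : (i : ℝ) ≤ j := by exact_mod_cast hij
      exact ⟨⟨by linarith [hz.1.1], by linarith [hz.1.2]⟩, hz.2⟩) (by rwa [iUnion_rect])
  rw [iUnion_rect] at h1
  have h2 := h1.const_sub (∫ z in strip L, F z)
  rw [sub_self] at h2
  refine h2.congr fun m => ?_
  rw [setIntegral_sdiff (measurableSet_rect _ _ _ _) hF (rect_subset_strip le_rfl le_rfl)]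

theorem SobolevTriple.tripleEnergy_ne_top {u g h : ℝ × ℝ → ℂ} (H : SobolevTriple L u g h) :
    tripleEnergy u g h (strip L) ≠ ⊤ := by
  have e : ∀ f : ℝ × ℝ → ℂ, MemLp f 2 (volume.restrict (strip L)) →
      ∫⁻ z in strip L, ‖f z‖ₑ ^ 2 ≠ ⊤ := fun f hf => by
    have := hf.eLpNorm_lt_top
    rw [eLpNorm_lt_top_iff_lintegral_rpow_enorm_lt_top (by norm_num) (by norm_num)] at this
    simpa using this.ne
  have m1 := H.memLp.1.enorm
  have m2 := H.dx.memLp.1.enorm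
  have m12 : AEMeasurable (fun z => ‖u z‖ₑ ^ 2 + ‖g z‖ₑ ^ 2) (volume.restrict (strip L)) :=
    (m1.pow_const 2).add (m2.pow_const 2)
  rw [tripleEnergy, lintegral_add_left' m12, lintegral_add_left' (m1.pow_const 2)]
  exact ENNReal.add_ne_top.2 ⟨ENNReal.add_ne_top.2 ⟨e _ H.memLp, e _ H.dx.memLp⟩, e _ H.dy.memLp⟩

theorem tripleEnergy_sub_le {u g h a k l : ℝ × ℝ → ℂ} (K : SobolevTriple L a k l) :
    tripleEnergy (fun z => u z - a z) (fun z => g z - k z) (fun z => h z - l z) (strip L) ≤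
      2 * (tripleEnergy u g h (strip L) + tripleEnergy a k l (strip L)) := by
  have m1 := K.memLp.1.enorm
  have m2 := K.dx.memLp.1.enorm
  have m3 := K.dy.memLp.1.enorm
  have e : ∀ x y : ℂ, ‖x - y‖ₑ ^ 2 ≤ 2 * (‖x‖ₑ ^ 2 + ‖y‖ₑ ^ 2) := fun x y =>
    (pow_le_pow_left' (enorm_sub_le) 2).trans (sq_add_le _ _)
  have m : AEMeasurable (fun z => ‖a z‖ₑ ^ 2 + ‖k z‖ₑ ^ 2 + ‖l z‖ₑ ^ 2)
      (volume.restrict (strip L)) := ((m1.pow_const 2).add (m2.pow_const 2)).add (m3.pow_const 2)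
  simp only [tripleEnergy]
  rw [← lintegral_add_right' _ m, ← lintegral_const_mul' _ _ (by norm_num)]
  refine lintegral_mono fun z => ?_
  refine (add_le_add (add_le_add (e _ _) (e _ _)) (e _ _)).trans (le_of_eq ?_)
  ring

theorem SobolevTriple.memLp_rpow (hL : 0 < L) {q : ℝ} (hq : 2 ≤ q) {u g h : ℝ × ℝ → ℂ}
    (H : SobolevTriple L u g h) : MemLp u (ENNReal.ofReal q) (volume.restrict (strip L)) := by
  obtain ⟨C, hC, hS⟩ := exists_sobolev_rpow_strip hL hq
  refine memLp_of_lintegral_rpow_ne_top H.memLp.1 (by linarith) (ne_top_of_le_ne_top ?_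
    (hS u g h H))
  exact ENNReal.mul_ne_top hC (ENNReal.rpow_ne_top_of_nonneg (by linarith) H.tripleEnergy_ne_top)

theorem exists_integral_rpow_bound (hL : 0 < L) {q : ℝ} (hq : 2 ≤ q) {M : ℝ≥0∞} (hM : M ≠ ⊤) :
    ∃ K : ℝ, ∀ u g h, SobolevTriple L u g h → tripleEnergy u g h (strip L) ≤ M →
      ∫ z in strip L, ‖u z‖ ^ q ≤ K := by
  obtain ⟨C, hC, hS⟩ := exists_sobolev_rpow_strip hL hq
  refine ⟨(C * M ^ (q / 2)).toReal, fun u g h H hle => ?_⟩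
  rw [integral_rpow_eq_toReal H.memLp.1 (by linarith)]
  refine ENNReal.toReal_mono (ENNReal.mul_ne_top hC (ENNReal.rpow_ne_top_of_nonneg (by linarith)
    hM)) ((hS u g h H).trans ?_)
  exact mul_le_mul_right (ENNReal.rpow_le_rpow hle (by linarith)) _

theorem WeakTendsto.sub_self {ι : Type*} {l : Filter ι} {μ : Measure (ℝ × ℝ)}
    {x : ι → ℝ × ℝ → ℂ} {a : ℝ × ℝ → ℂ} (h : WeakTendsto μ x l a) (hx : ∀ i, MemLp (x i) 2 μ)
    (ha : MemLp a 2 μ) : WeakTendsto μ (fun i z => x i z - a z) l 0 := by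
  intro e he
  have h1 := (h e he).sub_const (∫ z, e z * a z ∂μ)
  simp only [_root_.sub_self] at h1
  simp only [Pi.zero_apply, mul_zero, integral_zero]
  refine h1.congr fun i => ?_
  simp only [mul_sub]
  exact (integral_sub (he.integrable_mul (hx i)) (he.integrable_mul ha)).symm

/-- The Brezis–Lieb splitting for weakly convergent sequences in `H¹` of the strip. -/
theorem tendsto_potential_sub {p : ℝ} (hL : 0 < L) (hp : 1 < p) {ι : Type*} {l : Filter ι}
    {x g h : ι → ℝ × ℝ → ℂ} {a k j : ℝ × ℝ → ℂ} (H : ∀ i, SobolevTriple L (x i) (g i) (h i))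
    (Ha : SobolevTriple L a k j) (hx : WeakTendsto (volume.restrict (strip L)) x l a)
    {M : ℝ≥0∞} (hM : M ≠ ⊤) (hb : ∀ i, tripleEnergy (x i) (g i) (h i) (strip L) ≤ M) :
    Tendsto (fun i => potential L p (x i) - potential L p (fun z => x i z - a z)) l
      (𝓝 (potential L p a)) := by
  set q := p + 1 with hq
  have hq0 : 0 < q := by linarith
  have hq1 : 1 ≤ q := by linarith
  have hq2 : 2 ≤ q := by linarith
  set M' : ℝ≥0∞ := 2 * (M + tripleEnergy a k j (strip L)) with hM'
  have hMt : M' ≠ ⊤ := ENNReal.mul_ne_top (by norm_num)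
    (ENNReal.add_ne_top.2 ⟨hM, Ha.tripleEnergy_ne_top⟩)
  set v : ι → ℝ × ℝ → ℂ := fun i z => x i z - a z with hv
  have Hv : ∀ i, SobolevTriple L (v i) _ _ := fun i => (H i).sub Ha
  have hbv : ∀ i, tripleEnergy (v i) (fun z => g i z - k z) (fun z => h i z - j z) (strip L) ≤ M' :=
    fun i => (tripleEnergy_sub_le Ha).trans (mul_le_mul_right (add_le_add_left (hb i) _) _)
  have hv0 : WeakTendsto (volume.restrict (strip L)) v l 0 :=
    hx.sub_self (fun i => (H i).memLp) Ha.memLp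
  obtain ⟨K₁, hK₁⟩ := exists_integral_rpow_bound hL hq2 hM
  obtain ⟨K₂, hK₂⟩ := exists_integral_rpow_bound hL hq2 hMt
  set K : ℝ := max K₁ K₂ ^ q⁻¹ with hK
  have mx : ∀ i, MemLp (x i) (ENNReal.ofReal q) (volume.restrict (strip L)) := fun i =>
    (H i).memLp_rpow hL hq2
  have mv : ∀ i, MemLp (v i) (ENNReal.ofReal q) (volume.restrict (strip L)) := fun i =>
    (Hv i).memLp_rpow hL hq2
  have ma : MemLp a (ENNReal.ofReal q) (volume.restrict (strip L)) := Ha.memLp_rpow hL hq2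
  set R : ℕ → Set (ℝ × ℝ) := fun m => rect (-((m : ℝ) + 1)) (m + 1) 0 L with hR
  have hRs : ∀ m, R m ⊆ strip L := fun m => rect_subset_strip le_rfl le_rfl
  have hRm : ∀ m, MeasurableSet (R m) := fun m => measurableSet_rect _ _ _ _
  have resR : ∀ m {f : ℝ × ℝ → ℂ}, MemLp f (ENNReal.ofReal q) (volume.restrict (strip L)) →
      MemLp f (ENNReal.ofReal q) (volume.restrict (R m)) := fun m f hf =>
    hf.mono_measure (Measure.restrict_mono (hRs m) le_rfl)
  have resT : ∀ m {f : ℝ × ℝ → ℂ}, MemLp f (ENNReal.ofReal q) (volume.restrict (strip L)) →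
      MemLp f (ENNReal.ofReal q) (volume.restrict (strip L \ R m)) := fun m f hf =>
    hf.mono_measure (Measure.restrict_mono sdiff_subset le_rfl)
  have split : ∀ m {f : ℝ × ℝ → ℂ}, MemLp f (ENNReal.ofReal q) (volume.restrict (strip L)) →
      potential L p f = (∫ z in R m, ‖f z‖ ^ q) + ∫ z in strip L \ R m, ‖f z‖ ^ q := by
    intro m f hf
    rw [setIntegral_sdiff (hRm m) (hf.integrable_rpow hq0) (hRs m), add_sub_cancel]
    rfl
  rw [Metric.tendsto_nhds]
  intro ε hε
  have hε4 : 0 < ε / 4 := by linarith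
  -- All L^q norms involved lie in [0, K], so uniform continuity of s ↦ s^q turns closeness of norms
  -- into closeness of their q-th powers.
  obtain ⟨η, hη, huc⟩ := Metric.uniformContinuousOn_iff.1
    (isCompact_Icc.uniformContinuousOn_of_continuous (s := Icc 0 K) (f := fun s : ℝ => s ^ q)
      (Real.continuous_rpow_const hq0.le).continuousOn) (ε / 4) hε4
  have tailP := tendsto_integral_tail (L := L) (ma.integrable_rpow hq0)
  have tailN : Tendsto (fun m => powNorm (volume.restrict (strip L \ R m)) q a) atTop (𝓝 0) := by
    have := ((Real.continuous_rpow_const (inv_nonneg.2 hq0.le)).tendsto 0).comp tailP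
    rwa [Real.zero_rpow (inv_ne_zero hq0.ne')] at this
  -- The rectangle is chosen so that a is small outside it. Inside, v tends to 0 in L^q; outside, x
  -- and v differ by a alone. No pointwise convergence is needed.
  obtain ⟨m, hm1, hm2⟩ := ((tailP.eventually_lt_const hε4).and (tailN.eventually_lt_const hη)).exists
  have locP : Tendsto (fun i => ∫ z in R m, ‖v i z‖ ^ q) l (𝓝 0) := by
    have h1 := tendsto_lintegral_rpow_rect hL hp Hv hv0 hMt hbv
      (a := -((m : ℝ) + 1)) (b := m + 1) (by linarith [Nat.cast_nonneg (α := ℝ) m])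
    have h2 := (ENNReal.tendsto_toReal ENNReal.zero_ne_top).comp h1
    refine h2.congr fun i => ?_
    rw [integral_rpow_eq_toReal (resR m (mv i)).1 hq0.le]
    rfl
  have locN : Tendsto (fun i => powNorm (volume.restrict (R m)) q (v i)) l (𝓝 0) := by
    have := ((Real.continuous_rpow_const (inv_nonneg.2 hq0.le)).tendsto 0).comp locP
    rwa [Real.zero_rpow (inv_ne_zero hq0.ne')] at this
  have locX : Tendsto (fun i => powNorm (volume.restrict (R m)) q (x i)) l
      (𝓝 (powNorm (volume.restrict (R m)) q a)) := by
    rw [tendsto_iff_norm_sub_tendsto_zero]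
    exact squeeze_zero (fun i => norm_nonneg _)
      (fun i => abs_powNorm_sub_le hq1 (resR m (mx i)) (resR m ma)) locN
  have locPX : Tendsto (fun i => ∫ z in R m, ‖x i z‖ ^ q) l (𝓝 (∫ z in R m, ‖a z‖ ^ q)) := by
    have := ((Real.continuous_rpow_const hq0.le).tendsto _).comp locX
    rw [powNorm_rpow hq0] at this
    exact this.congr fun i => powNorm_rpow hq0 _
  have mem : ∀ (f : ℝ × ℝ → ℂ), MemLp f (ENNReal.ofReal q) (volume.restrict (strip L)) →
      ∫ z in strip L, ‖f z‖ ^ q ≤ max K₁ K₂ →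
      powNorm (volume.restrict (strip L \ R m)) q f ∈ Icc 0 K := fun f hf hle =>
    ⟨powNorm_nonneg _, powNorm_le_of_integral_le hq0 ((setIntegral_mono_set
      (hf.integrable_rpow hq0) (Eventually.of_forall fun z => by positivity)
      (sdiff_subset.eventuallyLE)).trans hle)⟩
  filter_upwards [(Metric.tendsto_nhds.1 locP) _ hε4, (Metric.tendsto_nhds.1 locPX) _ hε4]
    with i h1 h2
  have h3 := huc _ (mem (x i) (mx i) ((hK₁ _ _ _ (H i) (hb i)).trans (le_max_left _ _)))
    _ (mem (v i) (mv i) ((hK₂ _ _ _ (Hv i) (hbv i)).trans (le_max_right _ _))) (by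
      rw [Real.dist_eq]
      refine (abs_powNorm_sub_le hq1 (resT m (mx i)) (resT m (mv i))).trans_lt ?_
      simpa [hv] using hm2)
  simp only [powNorm_rpow hq0] at h3
  have h4 : 0 ≤ ∫ z in strip L \ R m, ‖a z‖ ^ q := integral_nonneg fun z => by positivity
  rw [Real.dist_eq, abs_lt] at h1 h2 h3 ⊢
  rw [split m (mx i), split m (mv i), split m ma]
  constructor <;> linarith [h1.1, h1.2, h2.1, h2.2, h3.1, h3.2]

end

/-! ### The Nehari set and the quadratic part of the action -/

section

variable {L p ω : ℝ}

/-- The quadratic part `‖∇u‖² + ω ‖u‖²` of the Nehari functional. -/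
def nehariQuad (L ω : ℝ) (u : ℝ × ℝ → ℂ) : ℝ := gradSq L u + ω * massSq L u

theorem MemH1.sobolevTriple {u : ℝ × ℝ → ℂ} (hu : MemH1 L u) :
    SobolevTriple L u (weakDeriv L (1, 0) u) (weakDeriv L (0, 1) u) :=
  ⟨hu.memLp, weakDeriv_spec hu.exists_dx, weakDeriv_spec hu.exists_dy⟩

namespace SobolevTriple

variable {u g h : ℝ × ℝ → ℂ}

theorem memH1 (H : SobolevTriple L u g h) : MemH1 L u := ⟨H.memLp, ⟨g, H.dx⟩, ⟨h, H.dy⟩⟩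

theorem nehariQuad_eq (H : SobolevTriple L u g h) (ω : ℝ) :
    nehariQuad L ω u = (∫ z in strip L, ‖g z‖ ^ 2) + (∫ z in strip L, ‖h z‖ ^ 2) +
      ω * ∫ z in strip L, ‖u z‖ ^ 2 := by
  have h1 := (weakDeriv_spec ⟨g, H.dx⟩).ae_eq H.dx
  have h2 := (weakDeriv_spec ⟨h, H.dy⟩).ae_eq H.dy
  rw [nehariQuad, gradSq, massSq, ← integral_add H.dx.memLp.integrable_norm_sq
    H.dy.memLp.integrable_norm_sq]
  congr 1
  refine integral_congr_ae ?_
  filter_upwards [h1, h2] with z e1 e2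
  rw [e1, e2]

theorem nehariQuad_nonneg (H : SobolevTriple L u g h) (hω : 0 < ω) : 0 ≤ nehariQuad L ω u := by
  rw [H.nehariQuad_eq]
  have h1 : 0 ≤ ∫ z in strip L, ‖g z‖ ^ 2 := integral_nonneg fun z => by positivity
  have h2 : 0 ≤ ∫ z in strip L, ‖h z‖ ^ 2 := integral_nonneg fun z => by positivity
  have h3 : 0 ≤ ∫ z in strip L, ‖u z‖ ^ 2 := integral_nonneg fun z => by positivity
  positivity

theorem nehariQuad_pos (H : SobolevTriple L u g h) (hω : 0 < ω)
    (h0 : ¬ u =ᵐ[volume.restrict (strip L)] 0) : 0 < nehariQuad L ω u := by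
  rw [H.nehariQuad_eq]
  have h1 : 0 ≤ ∫ z in strip L, ‖g z‖ ^ 2 := integral_nonneg fun z => by positivity
  have h2 : 0 ≤ ∫ z in strip L, ‖h z‖ ^ 2 := integral_nonneg fun z => by positivity
  have h3 : 0 < ∫ z in strip L, ‖u z‖ ^ 2 := by
    refine lt_of_le_of_ne (integral_nonneg fun z => by positivity) fun h => h0 ?_
    rw [eq_comm, integral_eq_zero_iff_of_nonneg (fun z => by positivity)
      H.memLp.integrable_norm_sq] at h
    filter_upwards [h] with z hz
    simpa using hz
  positivity

theorem nehariQuad_const_mul (H : SobolevTriple L u g h) (ω : ℝ) (t : ℝ) :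
    nehariQuad L ω (fun z => (t : ℂ) * u z) = t ^ 2 * nehariQuad L ω u := by
  rw [(H.const_mul t).nehariQuad_eq, H.nehariQuad_eq]
  simp only [norm_mul, Complex.norm_real, mul_pow, integral_const_mul, Real.norm_eq_abs, sq_abs]
  ring

theorem nehariQuad_shift (H : SobolevTriple L u g h) (ω s : ℝ) :
    nehariQuad L ω (fun z => u (z + (s, 0))) = nehariQuad L ω u := by
  rw [(H.shift s).nehariQuad_eq, H.nehariQuad_eq, integral_shift L s fun z => ‖g z‖ ^ 2,
    integral_shift L s fun z => ‖h z‖ ^ 2, integral_shift L s fun z => ‖u z‖ ^ 2]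

theorem quadEnergy_eq (H : SobolevTriple L u g h) (hω : 0 < ω) :
    quadEnergy ω u g h (strip L) = ENNReal.ofReal (nehariQuad L ω u) := by
  have e : ∀ f : ℝ × ℝ → ℂ, MemLp f 2 (volume.restrict (strip L)) →
      ∫⁻ z in strip L, ‖f z‖ₑ ^ 2 = ENNReal.ofReal (∫ z in strip L, ‖f z‖ ^ 2) := fun f hf => by
    rw [ofReal_integral_eq_lintegral_ofReal hf.integrable_norm_sq
      (Eventually.of_forall fun z => by positivity)]
    refine lintegral_congr fun z => ?_
    rw [ENNReal.ofReal_pow (norm_nonneg _), ofReal_norm]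
  have m1 := H.memLp.1.enorm
  have m2 := H.dx.memLp.1.enorm
  have m12 : AEMeasurable (fun z => ENNReal.ofReal ω * ‖u z‖ₑ ^ 2 + ‖g z‖ₑ ^ 2)
    (volume.restrict (strip L)) := ((m1.pow_const 2).const_mul _).add (m2.pow_const 2)
  have n : ∀ f : ℝ × ℝ → ℂ, 0 ≤ ∫ z in strip L, ‖f z‖ ^ 2 := fun f =>
    integral_nonneg fun z => by positivity
  rw [quadEnergy, lintegral_add_left' m12, lintegral_add_left' ((m1.pow_const 2).const_mul _),
    lintegral_const_mul' _ _ (by finiteness), e _ H.memLp, e _ H.dx.memLp, e _ H.dy.memLp,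
    H.nehariQuad_eq, ← ENNReal.ofReal_mul hω.le,
    ← ENNReal.ofReal_add (mul_nonneg hω.le (n u)) (n g),
    ← ENNReal.ofReal_add (add_nonneg (mul_nonneg hω.le (n u)) (n g)) (n h)]
  congr 1
  ring

theorem potential_eq (H : SobolevTriple L u g h) (hL : 0 < L) (hp : 1 < p) :
    ENNReal.ofReal (potential L p u) = ∫⁻ z in strip L, ‖u z‖ₑ ^ (p + 1) := by
  have hm := H.memLp_rpow hL (q := p + 1) (by linarith)
  rw [potential, integral_rpow_eq_toReal H.memLp.1 (by linarith), ENNReal.ofReal_toReal]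
  have := hm.eLpNorm_lt_top
  rw [eLpNorm_lt_top_iff_lintegral_rpow_enorm_lt_top (by simp; linarith) (by simp),
    ENNReal.toReal_ofReal (by linarith)] at this
  exact this.ne

/-- Rescaling onto the Nehari manifold. -/
theorem exists_smul_mem_admissible (H : SobolevTriple L u g h) (hp : 1 < p) (hω : 0 < ω)
    (h0 : ¬ u =ᵐ[volume.restrict (strip L)] 0) (hP : 0 < potential L p u) :
    ∃ t : ℝ, 0 < t ∧ (nehariQuad L ω u ≤ potential L p u → t ≤ 1) ∧
      (fun z => (t : ℂ) * u z) ∈ admissible L p ω := by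
  have hQ := H.nehariQuad_pos hω h0
  have hp1 : 0 < p - 1 := by linarith
  -- This t solves t² Q(u) = t^{p+1} P(u).
  set t : ℝ := (nehariQuad L ω u / potential L p u) ^ (p - 1)⁻¹ with ht
  have ht0 : 0 < t := Real.rpow_pos_of_pos (div_pos hQ hP) _
  refine ⟨t, ht0, fun hle => ?_, (H.const_mul t).memH1, fun h => h0 ?_, ?_⟩
  · exact Real.rpow_le_one (div_pos hQ hP).le ((div_le_one hP).2 hle) (inv_nonneg.2 hp1.le)
  · filter_upwards [h] with z hz
    simpa [ht0.ne'] using hz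
  · have e1 : potential L p (fun z => (t : ℂ) * u z) = t ^ (p + 1) * potential L p u := by
      simp only [potential, norm_mul, Complex.norm_real, Real.norm_of_nonneg ht0.le,
        Real.mul_rpow ht0.le (norm_nonneg _), integral_const_mul]
    have e2 : t ^ (p + 1) = t ^ 2 * (nehariQuad L ω u / potential L p u) := by
      rw [show p + 1 = 2 + (p - 1) by ring, Real.rpow_add ht0, Real.rpow_two]
      congr 1
      rw [ht, Real.rpow_inv_rpow (div_pos hQ hP).le hp1.ne']
    have e3 : nehari L p ω (fun z => (t : ℂ) * u z) =
        nehariQuad L ω (fun z => (t : ℂ) * u z) - potential L p (fun z => (t : ℂ) * u z) := rfl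
    rw [e3, H.nehariQuad_const_mul, e1, e2]
    field_simp
    ring

end SobolevTriple

theorem potential_nonneg (L p : ℝ) (u : ℝ × ℝ → ℂ) : 0 ≤ potential L p u :=
  integral_nonneg fun z => by positivity

theorem nehariQuad_eq_potential {u : ℝ × ℝ → ℂ} (hu : u ∈ admissible L p ω) :
    nehariQuad L ω u = potential L p u := sub_eq_zero.1 hu.2.2

theorem action_eq_of_mem_admissible {u : ℝ × ℝ → ℂ} (hu : u ∈ admissible L p ω) :
    action L p ω u = (1 / 2 - 1 / (p + 1)) * nehariQuad L ω u := by
  have h := nehariQuad_eq_potential hu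
  rw [action, ← h, nehariQuad]
  ring

theorem not_ae_zero_of_potential_pos (hp : 1 < p) {u : ℝ × ℝ → ℂ} (h : 0 < potential L p u) :
    ¬ u =ᵐ[volume.restrict (strip L)] 0 := by
  intro h0
  refine h.ne' ?_
  rw [potential]
  refine integral_eq_zero_of_ae ?_
  filter_upwards [h0] with z hz
  simp only [hz, Pi.zero_apply, norm_zero]
  exact Real.zero_rpow (by linarith)

theorem potential_pos (hL : 0 < L) (hp : 1 < p) {u g h : ℝ × ℝ → ℂ} (H : SobolevTriple L u g h)
    (h0 : ¬ u =ᵐ[volume.restrict (strip L)] 0) : 0 < potential L p u := by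
  refine lt_of_le_of_ne (potential_nonneg L p u) fun h => h0 ?_
  have hi := (H.memLp_rpow hL (q := p + 1) (by linarith)).integrable_rpow (by linarith)
  rw [eq_comm, potential, integral_eq_zero_iff_of_nonneg (fun z => by positivity) hi] at h
  filter_upwards [h] with z hz
  have : ‖u z‖ = 0 := by
    by_contra hne
    exact (Real.rpow_pos_of_pos (lt_of_le_of_ne (norm_nonneg _) (Ne.symm hne)) (p + 1)).ne' hz
  simpa using this

theorem hasL2WeakDeriv_of_contDiff {f : ℝ × ℝ → ℂ} (hf : ContDiff ℝ 1 f)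
    (hc : HasCompactSupport f) (v : ℝ × ℝ) (hs : tsupport f ⊆ openStrip L) :
    HasL2WeakDeriv L v f (fun z => fderiv ℝ f z v) := by
  have cv := continuous_fderiv_dir hf v
  have hcv : HasCompactSupport fun z => fderiv ℝ f z v := hc.fderiv_apply ℝ v
  refine ⟨cv.memLp_of_hasCompactSupport hcv, fun φ hφ => ?_⟩
  have hsub : openStrip L ⊆ strip L := fun z hz => ⟨mem_univ _, hz.2.1.le, hz.2.2.le⟩
  have z1 : ∀ z, z ∉ strip L → f z = 0 := fun z hz =>
    image_eq_zero_of_notMem_tsupport fun h => hz (hsub (hs h))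
  have z2 : ∀ z, z ∉ strip L → φ z = 0 := fun z hz =>
    image_eq_zero_of_notMem_tsupport fun h => hz (hsub (hφ.supp h))
  rw [setIntegral_eq_integral_of_forall_compl_eq_zero (fun z hz => by rw [z1 z hz, smul_zero]),
    setIntegral_eq_integral_of_forall_compl_eq_zero (fun z hz => by rw [z2 z hz, zero_smul])]
  have mf : MemLp f 2 (volume : Measure (ℝ × ℝ)) := hf.continuous.memLp_of_hasCompactSupport hc
  have mv : MemLp (fun z => fderiv ℝ f z v) 2 (volume : Measure (ℝ × ℝ)) :=
    cv.memLp_of_hasCompactSupport hcv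
  have hd : ∀ z, HasFDerivAt (fun z => (φ z : ℂ)) (Complex.ofRealCLM.comp (fderiv ℝ φ z)) z :=
    fun z => Complex.ofRealCLM.hasFDerivAt.comp z (hφ.smooth.differentiable (by simp) z).hasFDerivAt
  have hd' : ∀ z, fderiv ℝ (fun z => (φ z : ℂ)) z v = ((fderiv ℝ φ z v : ℝ) : ℂ) := fun z => by
    rw [(hd z).fderiv]; rfl
  have key := integral_mul_fderiv_eq_neg_fderiv_mul_of_integrable (μ := volume)
    (f := fun z => (φ z : ℂ)) (g := f) (v := v)
    (by simp only [hd']; exact (hφ.memLp_fderiv v volume).integrable_mul mf)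
    ((hφ.memLp volume).integrable_mul mv) ((hφ.memLp volume).integrable_mul mf)
    (fun z _ => (hd z).differentiableAt) (fun z _ => hf.differentiable one_ne_zero z)
  simp only [hd'] at key
  simp only [Complex.real_smul]
  rw [key, neg_neg]

/-- A bump function inside the open strip, rescaled. Non-emptiness makes `sInf` a genuine infimum,
approached by a sequence. -/
theorem admissible_nonempty (hL : 0 < L) (hp : 1 < p) (hω : 0 < ω) :
    (admissible L p ω).Nonempty := by
  let b : ContDiffBump ((0, L / 2) : ℝ × ℝ) :=
    ⟨L / 8, L / 4, by linarith, by linarith⟩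
  set f : ℝ × ℝ → ℂ := fun z => (b z : ℂ) with hf
  have cf : ContDiff ℝ 1 f := Complex.ofRealCLM.contDiff.comp b.contDiff
  have hc : HasCompactSupport f := b.hasCompactSupport.comp_left Complex.ofReal_zero
  have hball : Metric.closedBall ((0, L / 2) : ℝ × ℝ) (L / 4) ⊆ openStrip L := by
    intro z hz
    obtain ⟨-, h2⟩ := abs_le_of_mem_closedBall hz
    rw [abs_le] at h2
    simp only at h2
    exact ⟨mem_univ _, by linarith, by linarith⟩
  have hs : tsupport f ⊆ openStrip L := by
    refine Subset.trans ?_ hball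
    rw [← b.tsupport_eq]
    exact closure_mono fun z hz => by
      simp only [hf, Function.mem_support] at hz ⊢
      exact_mod_cast hz
  have H : SobolevTriple L f _ _ := ⟨cf.continuous.memLp_of_hasCompactSupport hc,
    hasL2WeakDeriv_of_contDiff cf hc (1, 0) hs, hasL2WeakDeriv_of_contDiff cf hc (0, 1) hs⟩
  have h0 : ¬ f =ᵐ[volume.restrict (strip L)] 0 := by
    intro h
    have hsub : Metric.ball ((0, L / 2) : ℝ × ℝ) (L / 4) ⊆ strip L := fun z hz => by
      have := hball (Metric.ball_subset_closedBall hz)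
      exact ⟨mem_univ _, this.2.1.le, this.2.2.le⟩
    have h1 := ae_restrict_of_ae_restrict_of_subset hsub h
    rw [ae_restrict_iff' Metric.isOpen_ball.measurableSet] at h1
    have h2 : volume (Metric.ball ((0, L / 2) : ℝ × ℝ) (L / 4)) = 0 := by
      refine measure_mono_null (fun z hz => ?_) h1
      simp only [mem_compl_iff, mem_ofPred_eq, Classical.not_imp]
      refine ⟨hz, fun hz0 => ?_⟩
      simp only [hf, Pi.zero_apply, Complex.ofReal_eq_zero] at hz0
      exact (b.pos_of_mem_ball hz).ne' hz0
    exact (Metric.measure_ball_pos volume ((0, L / 2) : ℝ × ℝ) (by linarith)).ne' h2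
  obtain ⟨t, -, -, ht⟩ := H.exists_smul_mem_admissible hp hω h0 (potential_pos hL hp H h0)
  exact ⟨_, ht⟩

/-! ### Minimizing sequence and existence of the minimizer -/

theorem bddBelow_nehariQuad (hω : 0 < ω) :
    BddBelow (nehariQuad L ω '' admissible L p ω) := by
  refine ⟨0, ?_⟩
  rintro _ ⟨u, hu, rfl⟩
  exact hu.1.sobolevTriple.nehariQuad_nonneg hω

/-- A minimizing sequence for the quadratic part on the Nehari manifold, translated so that it
does not vanish on the first block. -/
theorem exists_minimizing_sequence (hL : 0 < L) (hp : 1 < p) (hω : 0 < ω) :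
    ∃ δ : ℝ≥0∞, δ ≠ 0 ∧ ∃ x g h : ℕ → ℝ × ℝ → ℂ, (∀ n, SobolevTriple L (x n) (g n) (h n)) ∧
      (∀ n, nehariQuad L ω (x n) = potential L p (x n)) ∧
      Tendsto (fun n => nehariQuad L ω (x n)) atTop
        (𝓝 (sInf (nehariQuad L ω '' admissible L p ω))) ∧
      ∀ n, δ ≤ ∫⁻ z in block L 0, ‖x n z‖ₑ ^ (p + 1) := by
  obtain ⟨δ, hδ, hblock⟩ := exists_block_lower_bound (ω := ω) hL hp hω
  have hbdd := bddBelow_nehariQuad (L := L) (p := p) hω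
  obtain ⟨y, -, hy, hmem⟩ := exists_seq_tendsto_sInf
    ((admissible_nonempty hL hp hω).image (nehariQuad L ω)) hbdd
  choose u hu hQu using hmem
  have H : ∀ n, SobolevTriple L (u n) _ _ := fun n => (hu n).1.sobolevTriple
  have hk : ∀ n, ∃ k : ℤ, δ ≤ ∫⁻ z in block L k, ‖u n z‖ₑ ^ (p + 1) := by
    intro n
    refine hblock _ _ _ (H n) ?_ ?_ ?_
    · rw [(H n).quadEnergy_eq hω, ← (H n).potential_eq hL hp, nehariQuad_eq_potential (hu n)]
    · rw [(H n).quadEnergy_eq hω]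
      simpa using (H n).nehariQuad_pos hω (hu n).2.1
    · rw [(H n).quadEnergy_eq hω]
      exact ENNReal.ofReal_ne_top
  choose k hk using hk
  refine ⟨δ, hδ, fun n z => u n (z + ((k n : ℝ), 0)), _, _, fun n => (H n).shift (k n),
    fun n => ?_, ?_, fun n => (hk n).trans ?_⟩
  · rw [(H n).nehariQuad_shift, nehariQuad_eq_potential (hu n), potential, potential]
    exact (integral_shift L (k n) fun z => ‖u n z‖ ^ (p + 1)).symm
  · refine hy.congr fun n => ?_
    rw [(H n).nehariQuad_shift, hQu]
  · have hb : ∀ z ∈ block L (k n), z + (-(k n : ℝ), 0) ∈ block L 0 := by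
      intro z hz
      obtain ⟨⟨h1, h2⟩, h3, h4⟩ := hz
      refine ⟨⟨?_, ?_⟩, ?_, ?_⟩ <;> simp <;> linarith
    have := setLIntegral_add_le (measurableSet_rect _ _ _ _) (measurableSet_rect _ _ _ _) hb
      (fun z => ‖u n (z + ((k n : ℝ), 0))‖ₑ ^ (p + 1))
    refine le_trans (le_of_eq ?_) this
    refine lintegral_congr fun z => ?_
    have e : z + (-(k n : ℝ), 0) + ((k n : ℝ), 0) = z := by ext <;> simp
    rw [e]

/-- A nonzero weak limit of a minimizing sequence has nonpositive Nehari functional. -/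
theorem exists_nehari_nonpos (hL : 0 < L) (hp : 1 < p) (hω : 0 < ω) :
    ∃ a g h, SobolevTriple L a g h ∧ ¬ a =ᵐ[volume.restrict (strip L)] 0 ∧
      nehariQuad L ω a ≤ potential L p a ∧
      nehariQuad L ω a ≤ sInf (nehariQuad L ω '' admissible L p ω) := by
  obtain ⟨δ, hδ, x, g, h, H, hPQ, hlim, hlow⟩ := exists_minimizing_sequence hL hp hω
  set m := sInf (nehariQuad L ω '' admissible L p ω) with hm
  have hbdd := bddBelow_nehariQuad (L := L) (p := p) hω
  -- The relaxed constraint Q ≤ P already forces Q ≥ m; this is applied to the remainders, which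
  -- need not be admissible.
  have hmle : ∀ {w k l : ℝ × ℝ → ℂ}, SobolevTriple L w k l → 0 < potential L p w →
      nehariQuad L ω w ≤ potential L p w → m ≤ nehariQuad L ω w := by
    intro w k l W hP hle
    obtain ⟨t, ht0, ht1, hadm⟩ := W.exists_smul_mem_admissible hp hω
      (not_ae_zero_of_potential_pos hp hP) hP
    refine (csInf_le hbdd ⟨_, hadm, rfl⟩).trans ?_
    rw [W.nehariQuad_const_mul]
    exact mul_le_of_le_one_left (W.nehariQuad_nonneg hω) (pow_le_one₀ ht0.le (ht1 hle))
  obtain ⟨B, hB⟩ := hlim.bddAbove_range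
  have hQB : ∀ n, nehariQuad L ω (x n) ≤ B := fun n => hB ⟨n, rfl⟩
  have hn : ∀ f : ℝ × ℝ → ℂ, 0 ≤ ∫ z in strip L, ‖f z‖ ^ 2 := fun f =>
    integral_nonneg fun z => by positivity
  have b1 : ∀ n, ∫ z in strip L, ‖x n z‖ ^ 2 ≤ B / ω := fun n => by
    have h1 := hQB n
    rw [(H n).nehariQuad_eq] at h1
    rw [le_div_iff₀ hω]
    linarith [hn (g n), hn (h n)]
  have b2 : ∀ n, ∫ z in strip L, ‖g n z‖ ^ 2 ≤ B := fun n => by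
    have h1 := hQB n
    rw [(H n).nehariQuad_eq] at h1
    linarith [hn (h n), mul_nonneg hω.le (hn (x n))]
  have b3 : ∀ n, ∫ z in strip L, ‖h n z‖ ^ 2 ≤ B := fun n => by
    have h1 := hQB n
    rw [(H n).nehariQuad_eq] at h1
    linarith [hn (g n), mul_nonneg hω.le (hn (x n))]
  set U : Ultrafilter ℕ := hyperfilter ℕ with hU
  have hUle : (U : Filter ℕ) ≤ atTop := Nat.hyperfilter_le_atTop
  obtain ⟨a, ma, wa, -⟩ := exists_weakTendsto U (fun n => (H n).memLp) b1
  obtain ⟨k, mk, wk, -⟩ := exists_weakTendsto U (fun n => (H n).dx.memLp) b2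
  obtain ⟨j, mj, wj, -⟩ := exists_weakTendsto U (fun n => (H n).dy.memLp) b3
  have Ha : SobolevTriple L a k j := ⟨ma, .of_weakTendsto (fun n => (H n).dx) wa wk mk,
    .of_weakTendsto (fun n => (H n).dy) wa wj mj⟩
  have h0 : ENNReal.ofReal ω ≠ 0 := by simpa using hω
  have hi : (ENNReal.ofReal ω)⁻¹ ≠ ⊤ := ENNReal.inv_ne_top.2 h0
  set M : ℝ≥0∞ := (1 + (ENNReal.ofReal ω)⁻¹) * ENNReal.ofReal B with hM
  have hMt : M ≠ ⊤ := by finiteness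
  have hbM : ∀ n, tripleEnergy (x n) (g n) (h n) (strip L) ≤ M := fun n => by
    refine (tripleEnergy_le_quadEnergy hω _ _ _ _).trans (mul_le_mul_right ?_ _)
    rw [(H n).quadEnergy_eq hω]
    exact ENNReal.ofReal_le_ofReal (hQB n)
  have ha0 : ¬ a =ᵐ[volume.restrict (strip L)] 0 := by
    intro hz
    -- A zero weak limit would make the sequence vanish in L^{p+1} of the block at the origin,
    -- against the lower bound δ.
    have wx : WeakTendsto (volume.restrict (strip L)) x U 0 := by
      intro e he
      have := wa e he
      rwa [integral_congr_ae (g := fun z => e z * (0 : ℝ × ℝ → ℂ) z)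
        (hz.mono fun z hz => by simp only [hz])] at this
    have h1 := tendsto_lintegral_rpow_rect hL hp H wx hMt hbM zero_lt_one
    have h2 : δ ≤ 0 := ge_of_tendsto h1 (Eventually.of_forall fun n => by
      have := hlow n
      simpa [block] using this)
    exact hδ (le_antisymm h2 bot_le)
  have Hv : ∀ n, SobolevTriple L (fun z => x n z - a z) _ _ := fun n => (H n).sub Ha
  have hQlim : Tendsto (fun n => nehariQuad L ω (x n)) U (𝓝 m) := hlim.mono_left hUle
  have dQ : Tendsto (fun n => nehariQuad L ω (x n) - nehariQuad L ω (fun z => x n z - a z)) U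
      (𝓝 (nehariQuad L ω a)) := by
    have t1 := wa.tendsto_norm_sq_sub (fun n => (H n).memLp) ma
    have t2 := wk.tendsto_norm_sq_sub (fun n => (H n).dx.memLp) mk
    have t3 := wj.tendsto_norm_sq_sub (fun n => (H n).dy.memLp) mj
    have t := (t2.add t3).add (t1.const_mul ω)
    rw [← Ha.nehariQuad_eq] at t
    refine t.congr fun n => ?_
    rw [(H n).nehariQuad_eq, (Hv n).nehariQuad_eq]
    ring
  have hQv : Tendsto (fun n => nehariQuad L ω (fun z => x n z - a z)) U
      (𝓝 (m - nehariQuad L ω a)) := by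
    simpa using hQlim.sub dQ
  have hPv : Tendsto (fun n => potential L p (fun z => x n z - a z)) U
      (𝓝 (m - potential L p a)) := by
    have hPlim : Tendsto (fun n => potential L p (x n)) U (𝓝 m) := hQlim.congr hPQ
    simpa using hPlim.sub (tendsto_potential_sub hL hp H Ha wa hMt hbM)
  have hQa := Ha.nehariQuad_pos hω ha0
  refine ⟨a, k, j, Ha, ha0, ?_, ?_⟩
  -- The remainders have limits m − Q(a) < m − P(a), so eventually Q < P for them and the relaxed
  -- bound applies, forcing Q(a) ≤ 0.
  · by_contra! hlt
    have hev : ∀ᶠ n in (U : Filter ℕ), nehariQuad L ω (fun z => x n z - a z) <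
        potential L p (fun z => x n z - a z) := hQv.eventually_lt hPv (by linarith)
    have : m ≤ m - nehariQuad L ω a := ge_of_tendsto hQv (hev.mono fun n hn =>
      hmle (Hv n) (((Hv n).nehariQuad_nonneg hω).trans_lt hn) hn.le)
    linarith
  · have : 0 ≤ m - nehariQuad L ω a := ge_of_tendsto hQv (Eventually.of_forall fun n =>
      (Hv n).nehariQuad_nonneg hω)
    linarith

theorem exists_nonneg_minimizer (hL : 0 < L) (hp : 1 < p) (hω : 0 < ω) :
    ∃ φ : ℝ × ℝ → ℝ, (∀ z, 0 ≤ φ z) ∧ IsActionMinimizer L p ω (fun z => (φ z : ℂ)) := by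
  obtain ⟨a, g, h, H, ha0, hQP, hQm⟩ := exists_nehari_nonpos hL hp hω
  obtain ⟨G₁, hG₁, le₁⟩ := H.dx.exists_norm H.memLp
  obtain ⟨G₂, hG₂, le₂⟩ := H.dy.exists_norm H.memLp
  set w : ℝ × ℝ → ℂ := fun z => ((‖a z‖ : ℝ) : ℂ) with hw
  have W : SobolevTriple L w G₁ G₂ := ⟨H.memLp.norm.ofReal, hG₁, hG₂⟩
  have hnorm : ∀ z, ‖w z‖ = ‖a z‖ := fun z => by simp [hw]
  have hPw : potential L p w = potential L p a := by simp only [potential, hnorm]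
  have hQw : nehariQuad L ω w ≤ nehariQuad L ω a := by
    rw [W.nehariQuad_eq, H.nehariQuad_eq]
    simp only [hnorm]
    linarith
  have hP : 0 < potential L p w := hPw ▸ potential_pos hL hp H ha0
  obtain ⟨t, ht0, ht1, hadm⟩ := W.exists_smul_mem_admissible hp hω
    (not_ae_zero_of_potential_pos hp hP) hP
  -- Here Q(|a|) ≤ Q(a) ≤ P(a) = P(|a|), so the rescaling factor is at most 1 and Q(t|a|) ≤ m.
  have ht := ht1 (by linarith)
  refine ⟨fun z => t * ‖a z‖, fun z => by positivity, ?_⟩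
  have e : (fun z => ((t * ‖a z‖ : ℝ) : ℂ)) = fun z => (t : ℂ) * w z := by
    ext z; simp [hw]
  rw [e]
  have hbdd := bddBelow_nehariQuad (L := L) (p := p) hω
  have hc : 0 < 1 / 2 - 1 / (p + 1) := by
    rw [sub_pos]
    exact one_div_lt_one_div_of_lt (by norm_num) (by linarith)
  have hmin : ∀ u ∈ admissible L p ω,
      action L p ω (fun z => (t : ℂ) * w z) ≤ action L p ω u := by
    intro u hu
    rw [action_eq_of_mem_admissible hadm, action_eq_of_mem_admissible hu]
    refine mul_le_mul_of_nonneg_left ?_ hc.le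
    refine le_trans ?_ (csInf_le hbdd ⟨u, hu, rfl⟩)
    rw [W.nehariQuad_const_mul]
    exact (mul_le_of_le_one_left (W.nehariQuad_nonneg hω) (pow_le_one₀ ht0.le ht)).trans
      (hQw.trans hQm)
  refine ⟨hadm, hmin, ?_⟩
  have hleast : IsLeast (action L p ω '' admissible L p ω)
      (action L p ω (fun z => (t : ℂ) * w z)) := by
    refine ⟨⟨_, hadm, rfl⟩, ?_⟩
    rintro _ ⟨u, hu, rfl⟩
    exact hmin u hu
  exact hleast.csInf_eq.symm

end

end StripNLS

end

theorem mainTheorem8 (L p ω : ℝ) (hL : 0 < L) (hp : 1 < p) (hω : 0 < ω) :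
    ∃ φ : ℝ × ℝ → ℝ, (∀ z, 0 ≤ φ z) ∧
      StripNLS.IsActionMinimizer L p ω (fun z => (φ z : ℂ)) := by
  exact StripNLS.exists_nonneg_minimizer hL hp hω
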